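/- Let $(\Omega,\mathcal F,\mathbb P)$ be a probability space and let $\dot W=\{\dot W(h):h\in L_2((0,\pi))\}$ be Gaussian white noise on $L_2((0,\pi))$, that is, a collection of Gaussian random variables with $\mathbb E\,\dot W(g)=0$ and $\mathbb E\big(\dot W(g)\dot W(h)\big)=\int_0^\pi gh\,dx$. Let $\mathfrak m_0=1/\sqrt\pi$, $\mathfrak m_k(x)=\sqrt{2/\pi}\,\cos(kx)$ for $k\ge1$, and, for every multi-index $\alpha=(\alpha_0,\alpha_1,\dots)$ of non-negative integers with finitely many non-zero entries, $\xi_\alpha=\prod_k \mathrm{He}_{\alpha_k}(\dot W(\mathfrak m_k))/\sqrt{\alpha_k!}$, where $\mathrm{He}_n$ is the $n$-th (probabilists') Hermite polynomial. Denote by $\epsilon(k)$ the multi-index with $1$ in position $k$ and $0$ elsewhere. Let $T>0$ and $u_0\in L_1((0,\pi))$ (for example, $u_0\in L_r((0,\pi))$ for some $1\le r\le\infty$), with $u_0$ non-random and defined at every point of $[0,\pi]$. Consider the equation $$u_t=u_{xx}+u\diamond\dot W(x),\quad 0<t\le T,\ 0<x<\pi,\qquad u_x(t,0)=u_x(t,\pi)=0,\quad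 u(0,x)=u_0(x),$$ with $\diamond$ the Wick product. Its chaos solution on $[0,T]$ is the family of functions $u_\alpha(t,x)$, continuous on $(0,T]\times[0,\pi]$ and integrable over $(0,T)\times(0,\pi)$, that satisfies, in the weak sense and with zero Neumann boundary conditions, $$\partial_t u_\alpha=\partial_{xx}u_\alpha+\sum_k\sqrt{\alpha_k}\,\mathfrak m_k\,u_{\alpha-\epsilon(k)},\qquad u_{\mathbf 0}(0,\cdot)=u_0,\quad u_\alpha(0,\cdot)=0\ \text{ for }\alpha\ne\mathbf 0 .$$ Here "in the weak sense" means that the equation holds after multiplication by any $\varphi\in C^2$ with $\varphi'(0)=\varphi'(\pi)=0$, integration over $(0,\pi)$ with both $x$-derivatives moved to $\varphi$, and integration in time over $(0,t)$, for every $t\in(0,T]$. A random field solution on $[0,T]$ is a family of random variables $u(t,x)$, $t\in[0,T]$, $x\in[0,\pi]$, such that every $u(t,x)$ is square integrable, is (up to a null set) measurable with respect to the sigma-algebra generated by $\dot W$, and satisfies $\mathbb E\big(u(t,x)\xi_\alpha\big)=u_\alpha(t,x)$ for all $\alpha$. **Theorem.** Suppose that $u_0(x)\ge0$ for all $x\in[0,\pi]$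 and that $u$ is a random field solution of the equation such that $u\in L_2\big(\Omega\times[0,T];L_p((0,\pi))\big)$ for some $1\le p\le\infty$. Then $\mathbb P\big(u(t,x)\ge0\big)=1$ for all $t\in[0,T]$ and $x\in[0,\pi]$. Moreover, for every set $S\subseteq[0,T]\times[0,\pi]$ on which almost all sample functions of $u$ are continuous (such as $S=[0,T]\times[0,\pi]$ or $S=(0,T]\times[0,\pi]$, if $u$ is continuous there), there is a single event of probability one on which $u(t,x)\ge0$ for all $(t,x)\in S$ simultaneously. -/

import Mathlib

open MeasureTheory ProbabilityTheory Set

open scoped ENNReal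

namespace WickHeat

/-- Lebesgue measure on the interval `(0, π)`. -/
noncomputable def leb : Measure ℝ := volume.restrict (Ioo 0 Real.pi)

instance : IsFiniteMeasure leb := by
  unfold leb
  exact ⟨by simp⟩

/-- The Fourier cosine basis of `L₂((0, π))`, numbered from `0`:
`m₀ = 1/√π` and `mₖ(x) = √(2/π) cos(kx)` for `k ≥ 1`. -/
noncomputable def cosFun (k : ℕ) (x : ℝ) : ℝ :=
  if k = 0 then 1 / Real.sqrt Real.pi else Real.sqrt (2 / Real.pi) * Real.cos (k * x)

theorem continuous_cosFun (k : ℕ) : Continuous (cosFun k) := by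
  unfold cosFun
  split_ifs <;> fun_prop

theorem abs_cosFun_le (k : ℕ) (x : ℝ) :
    |cosFun k x| ≤ 1 / Real.sqrt Real.pi + Real.sqrt (2 / Real.pi) := by
  have h1 : 0 ≤ 1 / Real.sqrt Real.pi := by positivity
  have h2 : 0 ≤ Real.sqrt (2 / Real.pi) := by positivity
  unfold cosFun
  split_ifs
  · rw [abs_of_nonneg h1]
    linarith
  · rw [abs_mul, abs_of_nonneg h2]
    have := mul_le_mul_of_nonneg_left (Real.abs_cos_le_one (k * x)) h2
    linarith

theorem memLp_cosFun (k : ℕ) : MemLp (cosFun k) 2 leb :=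
  MemLp.of_bound (continuous_cosFun k).aestronglyMeasurable
    (1 / Real.sqrt Real.pi + Real.sqrt (2 / Real.pi))
    (Filter.Eventually.of_forall fun x => abs_cosFun_le k x)

/-- The cosine basis as elements of the Hilbert space `L₂((0, π))`. -/
noncomputable def cosLp (k : ℕ) : Lp ℝ 2 leb := (memLp_cosFun k).toLp (cosFun k)

/-- Gaussian white noise on `L₂((0, π))`: centred Gaussian random variables `W h`,
`h ∈ L₂((0, π))`, with `E (W g * W h) = (g, h)`. -/
structure IsWhiteNoise {Ω : Type*} [MeasurableSpace Ω] (P : Measure Ω)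
    (W : Lp ℝ 2 leb → Ω → ℝ) : Prop where
  measurable : ∀ h, Measurable (W h)
  gaussian : ∀ h, IsGaussian (P.map (W h))
  mean : ∀ h, ∫ ω, W h ω ∂P = 0
  covariance : ∀ g h, ∫ ω, W g ω * W h ω ∂P = inner ℝ g h

/-- The sigma-algebra generated by the white noise. -/
abbrev sigmaW {Ω : Type*} (W : Lp ℝ 2 leb → Ω → ℝ) : MeasurableSpace Ω :=
  ⨆ h, MeasurableSpace.comap (W h) (borel ℝ)

/-- `η ∈ L₂(W; ℝ)`: square integrable and, up to a null set, measurable with respect to the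
sigma-algebra generated by the white noise. -/
def InL2W {Ω : Type*} [MeasurableSpace Ω] (P : Measure Ω)
    (W : Lp ℝ 2 leb → Ω → ℝ) (η : Ω → ℝ) : Prop :=
  AEStronglyMeasurable[sigmaW W] η P ∧ MemLp η 2 P

/-- Multi-indices: finitely supported sequences of natural numbers. -/
abbrev MultiIndex : Type := ℕ →₀ ℕ

/-- The Cameron–Martin element
`ξ_α = ∏ₖ He_{αₖ}(W(mₖ)) / √(αₖ!)`, with `He_n` the probabilists' Hermite polynomials. -/
noncomputable def xi {Ω : Type*} (W : Lp ℝ 2 leb → Ω → ℝ) (α : MultiIndex) (ω : Ω) : ℝ :=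
  ∏ k ∈ α.support,
    Polynomial.aeval (W (cosLp k) ω) (Polynomial.hermite (α k)) / Real.sqrt ((α k).factorial)

/-- The source term `∑ₖ √αₖ mₖ(x) U_{α - ε(k)}(s, x)` of the propagator. -/
noncomputable def source (U : MultiIndex → ℝ → ℝ → ℝ) (α : MultiIndex) (s x : ℝ) : ℝ :=
  ∑ k ∈ α.support, Real.sqrt (α k) * cosFun k x * U (α - Finsupp.single k 1) s x

/-- The chaos solution on `[0, T]` of `u_t = u_xx + u ⋄ Ẇ` on `(0, π)` with zero Neumann boundary
conditions and initial value `u₀`: the functions `U α` satisfy the propagator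
`∂ₜ U_α = ∂ₓₓ U_α + ∑ₖ √αₖ mₖ U_{α - ε(k)}`, with `U_0(0) = u₀` and `U_α(0) = 0` for `α ≠ 0`.
The equation and the boundary conditions are understood in the weak sense (test functions are `C²`
up to the boundary and satisfy the Neumann condition); `U α` is continuous at positive times, so
its point values are meaningful. -/
structure IsChaosSolution (T : ℝ) (u₀ : ℝ → ℝ) (U : MultiIndex → ℝ → ℝ → ℝ) : Prop where
  continuousOn : ∀ α,
    ContinuousOn (fun z : ℝ × ℝ => U α z.1 z.2) (Ioc 0 T ×ˢ Icc 0 Real.pi)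
  integrableOn : ∀ α,
    IntegrableOn (fun z : ℝ × ℝ => U α z.1 z.2) (Ioc 0 T ×ˢ Icc 0 Real.pi)
  initial : ∀ α, ∀ x ∈ Icc 0 Real.pi, U α 0 x = if α = 0 then u₀ x else 0
  propagator : ∀ α, ∀ φ : ℝ → ℝ, ContDiff ℝ 2 φ → deriv φ 0 = 0 → deriv φ Real.pi = 0 →
    ∀ t ∈ Ioc 0 T,
      ∫ x in (0)..Real.pi, U α t x * φ x =
        (∫ x in (0)..Real.pi, U α 0 x * φ x) +
          ∫ s in (0)..t, ∫ x in (0)..Real.pi,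
            (U α s x * deriv (deriv φ) x + source U α s x * φ x)

/-- `u` is a random field solution on `[0, T]`: for all `t` and `x`, the random variable `u t x`
belongs to `L₂(W; ℝ)`, and its chaos coefficients `E (u t x * ξ_α)` are the values at `(t, x)` of
the chaos solution. -/
def IsRandomFieldSolution {Ω : Type*} [MeasurableSpace Ω] (P : Measure Ω)
    (W : Lp ℝ 2 leb → Ω → ℝ) (T : ℝ) (u₀ : ℝ → ℝ) (u : ℝ → ℝ → Ω → ℝ) : Prop :=
  ∃ U : MultiIndex → ℝ → ℝ → ℝ, IsChaosSolution T u₀ U ∧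
    ∀ t ∈ Icc 0 T, ∀ x ∈ Icc 0 Real.pi,
      InL2W P W (u t x) ∧ ∀ α, ∫ ω, u t x ω * xi W α ω ∂P = U α t x

/-- `u ∈ L₂(Ω × [0, T]; L_p((0, π)))` (Bochner space). -/
def InL2Lp {Ω : Type*} [MeasurableSpace Ω] (P : Measure Ω) (T : ℝ) (p : ℝ≥0∞) [Fact (1 ≤ p)]
    (u : ℝ → ℝ → Ω → ℝ) : Prop :=
  ∃ F : Ω × ℝ → Lp ℝ p leb,
    MemLp F 2 (P.prod (volume.restrict (Icc 0 T))) ∧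
      ∀ᵐ z ∂(P.prod (volume.restrict (Icc 0 T))), F z =ᵐ[leb] fun x => u z.2 x z.1

end WickHeat

namespace WickHeat

open Filter Topology MvPolynomial

/-- A closed set invariant under a family `G h`, `h > 0`, with right derivative `B` at `h = 0`,
is invariant under the linear flow `c' = B c`. -/
theorem mem_of_flow_of_invariant {E : Type*} [NormedAddCommGroup E] [NormedSpace ℝ E]
    [ProperSpace E] {K : Set E} (hK : IsClosed K) {B : E →L[ℝ] E} {G : ℝ → E →L[ℝ] E}
    (hG : Tendsto (fun h : ℝ => h⁻¹ • (G h - 1)) (𝓝[>] 0) (𝓝 B))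
    (hGK : ∀ h > 0, ∀ v ∈ K, G h v ∈ K) {c : ℝ → E} {T : ℝ}
    (hcont : ContinuousOn c (Icc 0 T))
    (hderiv : ∀ t ∈ Ico 0 T, HasDerivWithinAt c (B (c t)) (Ici t) t) (h0 : c 0 ∈ K) :
    ∀ t ∈ Icc 0 T, c t ∈ K := by
  have hne : K.Nonempty := ⟨_, h0⟩
  have key : ∀ t ∈ Icc 0 T, Metric.infDist (c t) K ≤ gronwallBound 0 ‖B‖ 0 (t - 0) := by
    refine le_gronwallBound_of_liminf_deriv_right_le (f' := fun t => ‖B‖ * Metric.infDist (c t) K)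
      ?_ ?_ ?_ ?_
    · exact (Metric.continuous_infDist_pt K).comp_continuousOn hcont
    · intro t ht r hr
      obtain ⟨k, hk, hdist⟩ := hK.exists_infDist_eq_dist hne (c t)
      have hshift : Tendsto (fun z : ℝ => z - t) (𝓝[>] t) (𝓝[>] 0) := by
        refine tendsto_nhdsWithin_iff.2 ⟨?_, ?_⟩
        · have : Tendsto (fun z : ℝ => z - t) (𝓝 t) (𝓝 (t - t)) := by
            exact (continuous_id.sub continuous_const).tendsto t
          rw [sub_self] at this
          exact this.mono_left nhdsWithin_le_nhds
        · filter_upwards [self_mem_nhdsWithin] with z hz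
          exact mem_Ioi.2 (sub_pos.2 (mem_Ioi.1 hz))
      have hG' := hG.comp hshift
      have hs := (hasDerivWithinAt_iff_tendsto_slope' (by simp)).1
        ((hderiv t ht).mono Ioi_subset_Ici_self)
      have hlim : Tendsto (fun z : ℝ => ‖slope c t z - ((z - t)⁻¹ • (G (z - t) - 1)) (c t)‖ +
          ‖(z - t)⁻¹ • (G (z - t) - 1)‖ * Metric.infDist (c t) K) (𝓝[>] t)
          (𝓝 (‖B (c t) - B (c t)‖ + ‖B‖ * Metric.infDist (c t) K)) := by
        refine (hs.sub ?_).norm.add (hG'.norm.mul_const _)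
        exact (ContinuousLinearMap.apply ℝ E (c t)).continuous.continuousAt.tendsto.comp hG'
      rw [sub_self, norm_zero, zero_add] at hlim
      refine Eventually.frequently ?_
      filter_upwards [hlim.eventually (gt_mem_nhds hr), self_mem_nhdsWithin] with z hz hzt
      refine lt_of_le_of_lt ?_ hz
      have hpos : 0 < z - t := sub_pos.2 hzt
      set h := z - t with hh
      have h1 : Metric.infDist (c z) K ≤ ‖c z - G h k‖ := by
        rw [← dist_eq_norm]
        exact Metric.infDist_le_dist_of_mem (hGK h hpos k hk)
      have h2 : c z - G h k = h • (slope c t z - (h⁻¹ • (G h - 1)) (c t)) +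
          (h • ((h⁻¹ • (G h - 1)) (c t - k)) + (c t - k)) := by
        simp only [slope, vsub_eq_sub, ← hh, smul_sub, _root_.smul_apply, smul_smul,
          mul_inv_cancel₀ hpos.ne', one_smul, _root_.sub_apply,
          one_apply_eq_self, map_sub]
        abel
      have h3 : ‖c t - k‖ = Metric.infDist (c t) K := by rw [hdist, dist_eq_norm]
      have h4 : ‖c z - G h k‖ ≤ h * ‖slope c t z - (h⁻¹ • (G h - 1)) (c t)‖ +
          (h * (‖h⁻¹ • (G h - 1)‖ * Metric.infDist (c t) K) + Metric.infDist (c t) K) := by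
        rw [h2]
        refine (norm_add_le _ _).trans (add_le_add ?_ ((norm_add_le _ _).trans ?_))
        · rw [norm_smul, Real.norm_of_nonneg hpos.le]
        · rw [norm_smul, Real.norm_of_nonneg hpos.le, ← h3]
          gcongr
          exact ContinuousLinearMap.le_opNorm _ _
      rw [inv_mul_le_iff₀ hpos]
      linarith
    · exact (Metric.infDist_zero_of_mem h0).le
    · intro t _
      simp
  intro t ht
  have h := key t ht
  rw [gronwallBound_ε0_δ0] at h
  exact (hK.mem_iff_infDist_zero hne).2 (le_antisymm h Metric.infDist_nonneg)

/-- Positivity of the linear functionals `c t` on a cone `K` of a finite-dimensional space is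
propagated by `(c t f)' = c t (A f)`, if `A` is the derivative at `0` of operators
preserving `K`. -/
theorem nonneg_of_flow_of_invariant {X : Type*} [AddCommGroup X] [Module ℝ X]
    [FiniteDimensional ℝ X] {K : Set X} {A : X → X} {G : ℝ → X → X}
    (hG : ∀ f, ∀ μ : Module.Dual ℝ X,
      Tendsto (fun h : ℝ => h⁻¹ * (μ (G h f) - μ f)) (𝓝[>] 0) (𝓝 (μ (A f))))
    (hGlin : ∀ h, IsLinearMap ℝ (G h))
    (hGK : ∀ h > 0, ∀ f ∈ K, G h f ∈ K) {c : ℝ → X → ℝ} {T : ℝ} (hT : 0 ≤ T)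
    (hlin : ∀ t ∈ Icc 0 T, IsLinearMap ℝ (c t))
    (hcont : ∀ f, ContinuousOn (fun t => c t f) (Icc 0 T))
    (hderiv : ∀ f, ∀ t ∈ Ico 0 T, HasDerivWithinAt (fun t => c t f) (c t (A f)) (Ici t) t)
    (h0 : ∀ f ∈ K, 0 ≤ c 0 f) : ∀ t ∈ Icc 0 T, ∀ f ∈ K, 0 ≤ c t f := by
  let b := Module.finBasis ℝ X
  let d := Module.finrank ℝ X
  have hexp : ∀ t ∈ Icc 0 T, ∀ f, c t f = ∑ j, b.repr f j * c t (b j) := by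
    intro t ht f
    have := congrArg ((hlin t ht).mk' (c t)) (b.sum_repr f)
    rw [map_sum] at this
    simpa using this.symm
  let Φ : Matrix (Fin d) (Fin d) ℝ →ₗ[ℝ] ((Fin d → ℝ) →L[ℝ] (Fin d → ℝ)) :=
    (LinearMap.toContinuousLinearMap.toLinearMap).comp (Matrix.toLin'.toLinearMap)
  have hΦ : Continuous Φ := LinearMap.continuous_of_finiteDimensional _
  have hΦa : ∀ M v, Φ M v = M.mulVec v := fun M v => rfl
  let MG : ℝ → Matrix (Fin d) (Fin d) ℝ := fun h => Matrix.of fun i j => b.repr (G h (b i)) j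
  let MA : Matrix (Fin d) (Fin d) ℝ := Matrix.of fun i j => b.repr (A (b i)) j
  let K' : Set (Fin d → ℝ) := {v | ∀ f ∈ K, 0 ≤ ∑ j, b.repr f j * v j}
  have hK' : IsClosed K' := by
    simp only [K', ofPred_forall]
    exact isClosed_iInter fun f => isClosed_iInter fun _ => isClosed_le continuous_const
      (continuous_finsetSum _ fun j _ => continuous_const.mul (continuous_apply j))
  have hone : Φ 1 = 1 := by
    ext v : 1
    simp [hΦa]
  have hGt : Tendsto (fun h : ℝ => h⁻¹ • (Φ (MG h) - 1)) (𝓝[>] 0) (𝓝 (Φ MA)) := by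
    have : ∀ h : ℝ, h⁻¹ • (Φ (MG h) - 1) = Φ (h⁻¹ • (MG h - 1)) := by
      intro h
      rw [map_smul, map_sub, hone]
    simp only [this]
    refine (hΦ.tendsto _).comp ?_
    refine tendsto_pi_nhds.2 fun i => tendsto_pi_nhds.2 fun j => ?_
    have := hG (b i) (b.coord j)
    refine this.congr fun h => ?_
    simp [MG, Matrix.one_apply, Finsupp.single_apply]
  have hres := mem_of_flow_of_invariant (c := fun t => fun i => c t (b i)) (T := T)
    hK' hGt ?_ ?_ ?_ ?_
  · intro t ht f hf
    rw [hexp t ht]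
    exact hres t ht f hf
  · intro h hh v hv f hf
    have h1 := hv (G h f) (hGK h hh f hf)
    have h2 : ∀ j, b.repr (G h f) j = ∑ i, b.repr f i * b.repr (G h (b i)) j := by
      intro j
      have := congrArg (fun g => b.coord j ((hGlin h).mk' (G h) g)) (b.sum_repr f)
      simp only [map_sum, map_smul] at this
      simpa using this.symm
    convert h1 using 1
    simp only [hΦa, Matrix.mulVec, dotProduct, h2, MG, Matrix.of_apply, Finset.mul_sum,
      Finset.sum_mul]
    rw [Finset.sum_comm]
    simp only [mul_assoc]
    rfl
  · exact continuousOn_pi.2 fun i => hcont (b i)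
  · intro t ht
    rw [hasDerivWithinAt_pi]
    intro i
    have h1 := hderiv (b i) t ht
    rw [hexp t (Ico_subset_Icc_self ht) (A (b i))] at h1
    exact h1
  · intro f hf
    have := h0 f hf
    rwa [hexp 0 ⟨le_rfl, hT⟩] at this

/-- Weak convergence in a finite-dimensional space follows from convergence along a separating
family of linear functionals. -/
theorem tendsto_dual_of_separating {X ι Y : Type*} [AddCommGroup X] [Module ℝ X]
    [FiniteDimensional ℝ X] {ℓ : Y → Module.Dual ℝ X} (hsep : ∀ f, (∀ y, ℓ y f = 0) → f = 0)
    {F : Filter ι} {w : ι → X} {w₀ : X} (h : ∀ y, Tendsto (fun i => ℓ y (w i)) F (𝓝 (ℓ y w₀)))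
    (μ : Module.Dual ℝ X) : Tendsto (fun i => μ (w i)) F (𝓝 (μ w₀)) := by
  have hspan : Submodule.span ℝ (range ℓ) = ⊤ := by
    rw [← Subspace.dualCoannihilator_dualAnnihilator_eq (W := Submodule.span ℝ (range ℓ)),
      Submodule.dualAnnihilator_eq_top_iff, eq_bot_iff]
    intro f hf
    refine hsep f fun y => ?_
    exact (Submodule.mem_dualCoannihilator f).1 hf _ (Submodule.subset_span ⟨y, rfl⟩)
  have hμ : μ ∈ Submodule.span ℝ (range ℓ) := hspan ▸ Submodule.mem_top
  induction hμ using Submodule.span_induction with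
  | mem x hx => obtain ⟨y, rfl⟩ := hx; exact h y
  | zero => simpa using tendsto_const_nhds
  | add a b _ _ ha hb => exact ha.add hb
  | smul r a _ ha => exact ha.const_mul r

/-- The weighted degree `∑ₖ (k + 1) βₖ` of a multi-index. -/
noncomputable def wdeg : MultiIndex →+ ℕ := Finsupp.weight fun k => k + 1

theorem wdeg_single (k n : ℕ) : wdeg (Finsupp.single k n) = n * (k + 1) := by
  simp [wdeg, Finsupp.weight_single]

theorem finite_wdeg_le (N : ℕ) : {β : MultiIndex | wdeg β ≤ N}.Finite := by
  refine Set.Finite.subset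
    (Finset.finite_toSet ((Finset.range N).finsupp fun _ => Finset.range (N + 1))) ?_
  intro β hβ
  have hβ : wdeg β ≤ N := hβ
  have key : ∀ k ∈ β.support, β k * (k + 1) ≤ N := by
    intro k hk
    refine le_trans ?_ hβ
    have : wdeg β = ∑ i ∈ β.support, β i * (i + 1) := by
      simp [wdeg, Finsupp.weight_apply, Finsupp.sum]
    rw [this]
    exact Finset.single_le_sum (f := fun i => β i * (i + 1)) (fun _ _ => Nat.zero_le _) hk
  rw [Finset.mem_coe, Finset.mem_finsupp_iff]
  constructor
  · intro k hk
    have h0 : 0 < β k := Nat.pos_of_ne_zero (Finsupp.mem_support_iff.1 hk)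
    have := key k hk
    rw [Finset.mem_range]
    nlinarith
  · intro k _
    rw [Finset.mem_range]
    by_cases hk : k ∈ β.support
    · have := key k hk
      nlinarith [Nat.zero_le (β k * k)]
    · rw [Finsupp.notMem_support_iff.1 hk]
      omega

/-- The function `x ↦ cos(jx) y^β` with values in the polynomials. -/
noncomputable def cosMonomial (j : ℤ) (β : MultiIndex) : ℝ → MvPolynomial ℕ ℝ :=
  fun x => monomial β (Real.cos (j * x))

/-- The span of the functions `x ↦ cos(jx) y^β` with `|j| + ∑ₖ (k + 1) βₖ ≤ N`. -/
noncomputable def cosSpace (N : ℕ) : Submodule ℝ (ℝ → MvPolynomial ℕ ℝ) :=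
  Submodule.span ℝ {f | ∃ (j : ℤ) (β : MultiIndex), j.natAbs + wdeg β ≤ N ∧ f = cosMonomial j β}

theorem cosMonomial_mem {j : ℤ} {β : MultiIndex} {N : ℕ} (h : j.natAbs + wdeg β ≤ N) :
    cosMonomial j β ∈ cosSpace N :=
  Submodule.subset_span ⟨j, β, h, rfl⟩

theorem cosSpace_mono {M N : ℕ} (h : M ≤ N) : cosSpace M ≤ cosSpace N := by
  refine Submodule.span_mono ?_
  rintro f ⟨j, β, hj, rfl⟩
  exact ⟨j, β, hj.trans h, rfl⟩

instance (N : ℕ) : FiniteDimensional ℝ (cosSpace N) := by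
  refine FiniteDimensional.span_of_finite ℝ ?_
  refine Set.Finite.subset (Set.Finite.image (fun p : ℤ × MultiIndex => cosMonomial p.1 p.2)
    ((Set.finite_Icc (-(N : ℤ)) N).prod (finite_wdeg_le N))) ?_
  rintro f ⟨j, β, h, rfl⟩
  refine ⟨(j, β), ⟨?_, ?_⟩, rfl⟩
  · exact mem_Icc.2 (by dsimp only; omega)
  · change wdeg β ≤ N
    omega

theorem cosMonomial_mul (i j : ℤ) (α β : MultiIndex) :
    cosMonomial i α * cosMonomial j β =
      (1 / 2 : ℝ) • (cosMonomial (i + j) (α + β) + cosMonomial (i - j) (α + β)) := by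
  funext x
  simp only [cosMonomial, Pi.mul_apply, monomial_mul, Pi.smul_apply, Pi.add_apply, ← map_add,
    smul_monomial]
  congr 1
  push_cast
  rw [add_mul, sub_mul, Real.cos_add, Real.cos_sub, smul_eq_mul]
  ring

theorem mul_mem_cosSpace {M N : ℕ} {f g : ℝ → MvPolynomial ℕ ℝ} (hf : f ∈ cosSpace M)
    (hg : g ∈ cosSpace N) : f * g ∈ cosSpace (M + N) := by
  have h := Submodule.mul_mem_mul hf hg
  rw [cosSpace, cosSpace, Submodule.span_mul_span] at h
  refine Submodule.span_le.2 ?_ h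
  rintro _ ⟨_, ⟨i, α, hi, rfl⟩, _, ⟨j, β, hj, rfl⟩, rfl⟩
  simp only [SetLike.mem_coe]
  rw [cosMonomial_mul]
  refine Submodule.smul_mem _ _ (Submodule.add_mem _ (cosMonomial_mem ?_) (cosMonomial_mem ?_))
  all_goals rw [map_add]; omega

theorem const_monomial_mem (β : MultiIndex) (r : ℝ) :
    (fun _ => monomial β r) ∈ cosSpace (wdeg β) := by
  have : (fun _ => monomial β r) = r • cosMonomial 0 β := by
    funext x
    simp [cosMonomial, smul_monomial]
  rw [this]
  exact Submodule.smul_mem _ _ (cosMonomial_mem (by simp))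

theorem one_mem_cosSpace : (1 : ℝ → MvPolynomial ℕ ℝ) ∈ cosSpace 0 := by
  have := const_monomial_mem 0 1
  rwa [map_zero] at this

theorem cosFun_eq (k : ℕ) :
    ∃ r : ℝ, ∀ x, cosFun k x = r * Real.cos ((k : ℤ) * x) := by
  by_cases hk : k = 0
  · refine ⟨1 / Real.sqrt Real.pi, fun x => ?_⟩
    simp [cosFun, hk]
  · refine ⟨Real.sqrt (2 / Real.pi), fun x => ?_⟩
    simp [cosFun, hk]

theorem C_cosFun_mem (k : ℕ) (r : ℝ) :
    (fun x => C (r * cosFun k x) : ℝ → MvPolynomial ℕ ℝ) ∈ cosSpace k := by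
  obtain ⟨s, hs⟩ := cosFun_eq k
  have : (fun x => C (r * cosFun k x) : ℝ → MvPolynomial ℕ ℝ) = (r * s) • cosMonomial k 0 := by
    funext x
    simp only [hs, cosMonomial, Pi.smul_apply, smul_monomial, C_apply, smul_eq_mul, mul_assoc]
  rw [this]
  exact Submodule.smul_mem _ _ (cosMonomial_mem (by simp))

theorem pow_mem_cosSpace {N : ℕ} {f : ℝ → MvPolynomial ℕ ℝ} (hf : f ∈ cosSpace N) (n : ℕ) :
    f ^ n ∈ cosSpace (n * N) := by
  induction n with
  | zero => simpa using one_mem_cosSpace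
  | succ n ih =>
    rw [pow_succ, Nat.succ_mul]
    exact mul_mem_cosSpace ih hf

theorem prod_mem_cosSpace {ι : Type*} (s : Finset ι) {N : ι → ℕ} {f : ι → ℝ → MvPolynomial ℕ ℝ}
    (hf : ∀ i ∈ s, f i ∈ cosSpace (N i)) : ∏ i ∈ s, f i ∈ cosSpace (∑ i ∈ s, N i) := by
  classical
  induction s using Finset.induction_on with
  | empty => simpa using one_mem_cosSpace
  | insert a s ha ih =>
    rw [Finset.prod_insert ha, Finset.sum_insert ha]
    exact mul_mem_cosSpace (hf a (Finset.mem_insert_self _ _))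
      (ih fun i hi => hf i (Finset.mem_insert_of_mem hi))

/-- The substitution `y ↦ y + h (m₀(x), m₁(x), …)`. -/
noncomputable def shiftVar (h : ℝ) (x : ℝ) : MvPolynomial ℕ ℝ →ₐ[ℝ] MvPolynomial ℕ ℝ :=
  aeval fun k => X k + C (h * cosFun k x)

theorem eval_shiftVar (h x : ℝ) (y : ℕ → ℝ) (p : MvPolynomial ℕ ℝ) :
    eval y (shiftVar h x p) = eval (fun k => y k + h * cosFun k x) p := by
  induction p using MvPolynomial.induction_on with
  | C a => simp [shiftVar]
  | add p q hp hq => simp [hp, hq]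
  | mul_X p i hp => rw [map_mul, map_mul, hp]; simp [shiftVar]

/-- One step of length `h` of the splitting scheme: the random walk step `x ↦ x ± √(2h)` followed
by the substitution `y ↦ y + h (m₀(x), m₁(x), …)`. -/
noncomputable def step (h : ℝ) (f : ℝ → MvPolynomial ℕ ℝ) : ℝ → MvPolynomial ℕ ℝ :=
  fun x => shiftVar h x ((1 / 2 : ℝ) • (f (x + √(2 * h)) + f (x - √(2 * h))))

theorem step_add (h : ℝ) (f g : ℝ → MvPolynomial ℕ ℝ) :
    step h (f + g) = step h f + step h g := by
  funext x
  simp only [step, Pi.add_apply, ← map_add, ← smul_add]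
  congr 2
  abel

theorem step_smul (h r : ℝ) (f : ℝ → MvPolynomial ℕ ℝ) : step h (r • f) = r • step h f := by
  funext x
  simp only [step, Pi.smul_apply, ← map_smul, ← smul_add]
  rw [smul_comm]

theorem step_cosMonomial (h : ℝ) (j : ℤ) (β : MultiIndex) :
    step h (cosMonomial j β) = Real.cos (j * √(2 * h)) •
      fun x => C (Real.cos (j * x)) * shiftVar h x (monomial β 1) := by
  funext x
  have : (1 / 2 : ℝ) • (cosMonomial j β (x + √(2 * h)) + cosMonomial j β (x - √(2 * h))) =
      (Real.cos (j * √(2 * h)) * Real.cos (j * x)) • monomial β 1 := by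
    simp only [cosMonomial, ← map_add, smul_monomial, smul_eq_mul, mul_one, mul_add, mul_sub,
      Real.cos_add, Real.cos_sub]
    congr 1
    ring
  rw [step, this, map_smul, Pi.smul_apply, mul_smul, ← smul_eq_C_mul]

theorem step_mem {N : ℕ} (h : ℝ) {f : ℝ → MvPolynomial ℕ ℝ} (hf : f ∈ cosSpace N) :
    step h f ∈ cosSpace N := by
  induction hf using Submodule.span_induction with
  | zero =>
    have : step h 0 = 0 := by simpa using step_smul h 0 0
    rw [this]
    exact Submodule.zero_mem _
  | add f g _ _ hf hg => rw [step_add]; exact Submodule.add_mem _ hf hg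
  | smul r f _ hf => rw [step_smul]; exact Submodule.smul_mem _ _ hf
  | mem f hf =>
    obtain ⟨j, β, hN, rfl⟩ := hf
    rw [step_cosMonomial]
    refine Submodule.smul_mem _ _ (cosSpace_mono hN ?_)
    have h1 : (fun x => C (Real.cos (j * x)) : ℝ → MvPolynomial ℕ ℝ) ∈ cosSpace j.natAbs :=
      cosMonomial_mem (β := 0) (by simp)
    have h2 : (fun x => shiftVar h x (monomial β 1)) ∈ cosSpace (wdeg β) := by
      have h3 : (fun x => shiftVar h x (monomial β 1)) =
          ∏ k ∈ β.support, (fun x => X k + C (h * cosFun k x)) ^ β k := by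
        funext x
        rw [Finset.prod_apply, shiftVar, aeval_monomial, map_one, one_mul, Finsupp.prod]
        rfl
      have h4 : wdeg β = ∑ k ∈ β.support, β k * (k + 1) := by
        simp [wdeg, Finsupp.weight_apply, Finsupp.sum]
      rw [h3, h4]
      refine prod_mem_cosSpace _ fun k _ => pow_mem_cosSpace ?_ _
      refine Submodule.add_mem _ ?_ (cosSpace_mono (Nat.le_succ k) (C_cosFun_mem k h))
      have := const_monomial_mem (Finsupp.single k 1) 1
      rwa [wdeg_single, one_mul] at this
    exact mul_mem_cosSpace h1 h2

/-- The functions with non-negative values at all `x` and `y`. -/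
def nonnegCone : Set (ℝ → MvPolynomial ℕ ℝ) := {f | ∀ x y, 0 ≤ eval y (f x)}

theorem step_mem_nonnegCone (h : ℝ) {f : ℝ → MvPolynomial ℕ ℝ} (hf : f ∈ nonnegCone) :
    step h f ∈ nonnegCone := by
  intro x y
  rw [step, eval_shiftVar, smul_eval, map_add]
  exact mul_nonneg (by norm_num) (add_nonneg (hf _ _) (hf _ _))

/-- The derivation `∑ₖ mₖ(x) ∂/∂yₖ`. -/
noncomputable def noiseDeriv (x : ℝ) : Derivation ℝ (MvPolynomial ℕ ℝ) (MvPolynomial ℕ ℝ) :=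
  mkDerivation ℝ fun k => C (cosFun k x)

theorem hasDerivAt_eval_shift (x : ℝ) (y : ℕ → ℝ) (p : MvPolynomial ℕ ℝ) :
    HasDerivAt (fun h : ℝ => eval (fun k => y k + h * cosFun k x) p)
      (eval y (noiseDeriv x p)) 0 := by
  induction p using MvPolynomial.induction_on with
  | C a =>
    have : noiseDeriv x (C a) = 0 := Derivation.map_algebraMap _ a
    simpa [this] using hasDerivAt_const (0 : ℝ) a
  | add p q hp hq =>
    simp only [map_add]
    exact hp.add hq
  | mul_X p i hp =>
    have h1 : HasDerivAt (fun h : ℝ => y i + h * cosFun i x) (cosFun i x) 0 := by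
      simpa using ((hasDerivAt_id (0 : ℝ)).mul_const (cosFun i x)).const_add (y i)
    have h2 := hp.mul h1
    have h3 : noiseDeriv x (X i) = C (cosFun i x) := by rw [noiseDeriv, mkDerivation_X]
    have h4 : eval y (noiseDeriv x (p * X i)) = eval y (noiseDeriv x p) * (y i + 0 * cosFun i x) +
        eval (fun k => y k + 0 * cosFun k x) p * cosFun i x := by
      simp [h3]
      ring
    rw [h4]
    simp only [map_mul, eval_X]
    exact h2

theorem tendsto_cos_sqrt (j : ℝ) :
    Tendsto (fun h : ℝ => h⁻¹ * (Real.cos (j * √(2 * h)) - 1)) (𝓝[>] 0) (𝓝 (-j ^ 2)) := by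
  have h1 : Tendsto (fun h : ℝ => -j ^ 2 * Real.sinc (j * √(2 * h) / 2) ^ 2) (𝓝[>] 0)
      (𝓝 (-j ^ 2)) := by
    have hc : Continuous fun h : ℝ => -j ^ 2 * Real.sinc (j * √(2 * h) / 2) ^ 2 := by
      have := Real.continuous_sinc
      fun_prop
    have := (hc.tendsto 0).mono_left (nhdsWithin_le_nhds (s := Ioi 0))
    simpa using this
  refine h1.congr' ?_
  filter_upwards [self_mem_nhdsWithin] with h hh
  have hh : 0 < h := mem_Ioi.1 hh
  set a := j * √(2 * h) / 2 with ha
  have h2 : j * √(2 * h) = 2 * a := by rw [ha]; ring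
  have h3 : a ^ 2 = j ^ 2 * h / 2 := by
    rw [ha, div_pow, mul_pow, Real.sq_sqrt (by positivity)]
    ring
  have h4 : Real.sin a = a * Real.sinc a := by
    by_cases h0 : a = 0
    · simp [h0]
    · rw [Real.sinc_of_ne_zero h0]
      field_simp
  have h5 : Real.cos (2 * a) - 1 = -2 * Real.sin a ^ 2 := by
    rw [Real.cos_two_mul]
    have := Real.sin_sq_add_cos_sq a
    linarith
  rw [h2, h5, h4, mul_pow, h3]
  field_simp

/-- The graph of the operator `∂²/∂x² + ∑ₖ mₖ(x) ∂/∂yₖ`. -/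
noncomputable def generatorGraph :
    Submodule ℝ ((ℝ → MvPolynomial ℕ ℝ) × (ℝ → MvPolynomial ℕ ℝ)) :=
  Submodule.span ℝ {F | ∃ (j : ℤ) (β : MultiIndex), F = (cosMonomial j β, fun x =>
    C (-(j : ℝ) ^ 2 * Real.cos (j * x)) * monomial β 1 +
      C (Real.cos (j * x)) * noiseDeriv x (monomial β 1))}

theorem noiseDeriv_monomial_mem (β : MultiIndex) :
    (fun x => noiseDeriv x (monomial β 1)) ∈ cosSpace (wdeg β) := by
  have h1 : (fun x => noiseDeriv x (monomial β 1)) = ∑ k ∈ β.support,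
      ((fun _ => monomial (β - Finsupp.single k 1) (β k : ℝ)) *
        fun x => C (1 * cosFun k x) : ℝ → MvPolynomial ℕ ℝ) := by
    funext x
    rw [noiseDeriv, mkDerivation_monomial, Finset.sum_apply, one_smul, Finsupp.sum]
    simp
  rw [h1]
  refine Submodule.sum_mem _ fun k hk => ?_
  refine cosSpace_mono ?_ (mul_mem_cosSpace (const_monomial_mem _ _) (C_cosFun_mem k 1))
  have h2 : β = (β - Finsupp.single k 1) + Finsupp.single k 1 := by
    refine (tsub_add_cancel_of_le ?_).symm
    rw [Finsupp.single_le_iff]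
    exact Nat.one_le_iff_ne_zero.2 (Finsupp.mem_support_iff.1 hk)
  have h3 := congrArg wdeg h2
  rw [map_add, wdeg_single] at h3
  omega

theorem exists_generatorGraph {N : ℕ} {f : ℝ → MvPolynomial ℕ ℝ} (hf : f ∈ cosSpace N) :
    ∃ g ∈ cosSpace N, (f, g) ∈ generatorGraph := by
  induction hf using Submodule.span_induction with
  | zero => exact ⟨0, Submodule.zero_mem _, Submodule.zero_mem _⟩
  | add f g _ _ hf hg =>
    obtain ⟨f', h1, h2⟩ := hf
    obtain ⟨g', h3, h4⟩ := hg
    exact ⟨f' + g', Submodule.add_mem _ h1 h3, Submodule.add_mem _ h2 h4⟩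
  | smul r f _ hf =>
    obtain ⟨f', h1, h2⟩ := hf
    exact ⟨r • f', Submodule.smul_mem _ _ h1, Submodule.smul_mem _ r h2⟩
  | mem f hf =>
    obtain ⟨j, β, hN, rfl⟩ := hf
    refine ⟨_, ?_, Submodule.subset_span ⟨j, β, rfl⟩⟩
    refine cosSpace_mono hN (Submodule.add_mem _ ?_ ?_)
    · have : (fun x => C (-(j : ℝ) ^ 2 * Real.cos (j * x)) * monomial β 1) =
          (-(j : ℝ) ^ 2) • cosMonomial j β := by
        funext x
        rw [C_mul_monomial, Pi.smul_apply, cosMonomial, smul_monomial, mul_one, smul_eq_mul]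
      rw [this]
      exact Submodule.smul_mem _ _ (cosMonomial_mem le_rfl)
    · have h1 : (fun x => C (Real.cos (j * x)) : ℝ → MvPolynomial ℕ ℝ) ∈ cosSpace j.natAbs :=
        cosMonomial_mem (β := 0) (by simp)
      exact mul_mem_cosSpace h1 (noiseDeriv_monomial_mem β)

theorem tendsto_step {F : (ℝ → MvPolynomial ℕ ℝ) × (ℝ → MvPolynomial ℕ ℝ)}
    (hF : F ∈ generatorGraph) (x : ℝ) (y : ℕ → ℝ) :
    Tendsto (fun h : ℝ => h⁻¹ * (eval y (step h F.1 x) - eval y (F.1 x))) (𝓝[>] 0)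
      (𝓝 (eval y (F.2 x))) := by
  induction hF using Submodule.span_induction with
  | zero =>
    have : ∀ h, step h 0 = 0 := fun h => by simpa using step_smul h 0 0
    simp [this]
  | add F G _ _ hF hG =>
    simp only [Prod.fst_add, Prod.snd_add, step_add, Pi.add_apply, map_add]
    refine (hF.add hG).congr fun h => ?_
    ring
  | smul r F _ hF =>
    simp only [Prod.smul_fst, Prod.smul_snd, step_smul, Pi.smul_apply, smul_eval]
    refine (hF.const_mul r).congr fun h => ?_
    ring
  | mem F hF =>
    obtain ⟨j, β, rfl⟩ := hF
    simp only [step_cosMonomial, Pi.smul_apply, smul_eval, map_mul, eval_C, eval_shiftVar, map_add]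
    have h1 := hasDerivAt_eval_shift x y (monomial β 1)
    have h2 := (hasDerivAt_iff_tendsto_slope.1 h1).mono_left
      (nhdsWithin_mono 0 fun a (ha : a ∈ Ioi (0 : ℝ)) => (ne_of_gt (mem_Ioi.1 ha) : a ≠ 0))
    have h3 := h1.continuousAt.tendsto.mono_left (nhdsWithin_le_nhds (s := Ioi 0))
    have h4 := ((tendsto_cos_sqrt j).mul_const (Real.cos (j * x))).mul h3
    have h5 := h4.add (h2.const_mul (Real.cos (j * x)))
    simp only [zero_mul, add_zero] at h5
    refine h5.congr fun h => ?_
    have h6 : eval y (cosMonomial j β x) = Real.cos (j * x) * eval y (monomial β 1) := by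
      simp [cosMonomial, eval_monomial]
    rw [h6, slope_def_field]
    simp only [zero_mul, add_zero, sub_zero]
    ring

theorem derivation_prod {R A ι : Type*} [CommRing R] [CommRing A] [Algebra R A] [DecidableEq ι]
    (D : Derivation R A A) (s : Finset ι) (f : ι → A) :
    D (∏ i ∈ s, f i) = ∑ i ∈ s, (∏ j ∈ s.erase i, f j) * D (f i) := by
  induction s using Finset.induction_on with
  | empty => simp
  | insert a s ha ih =>
    rw [Finset.prod_insert ha, Finset.sum_insert ha, D.leibniz, ih, Finset.erase_insert ha,
      smul_eq_mul, smul_eq_mul, Finset.mul_sum, add_comm]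
    congr 1
    refine Finset.sum_congr rfl fun i hi => ?_
    have hia : i ≠ a := fun h => ha (h ▸ hi)
    rw [Finset.erase_insert_of_ne hia.symm,
      Finset.prod_insert (fun h => ha (Finset.mem_of_mem_erase h)),
      mul_assoc]

theorem derivative_hermite_succ (n : ℕ) :
    Polynomial.derivative (Polynomial.hermite (n + 1)) =
      ((n : Polynomial ℤ) + 1) * Polynomial.hermite n := by
  induction n with
  | zero => simp
  | succ n ih =>
    rw [Polynomial.hermite_succ (n + 1), Polynomial.derivative_sub, Polynomial.derivative_mul, ih,
      Polynomial.derivative_mul, Polynomial.derivative_X]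
    have h : Polynomial.derivative ((n : Polynomial ℤ) + 1) = 0 := by
      simp
    rw [h, Polynomial.hermite_succ n]
    push_cast
    ring

theorem derivative_hermite (n : ℕ) :
    Polynomial.derivative (Polynomial.hermite n) =
      (n : Polynomial ℤ) * Polynomial.hermite (n - 1) := by
  cases n with
  | zero => simp
  | succ n => rw [derivative_hermite_succ]; simp

/-- The Hermite polynomial in the variable `y_k`. -/
noncomputable def hermVar (k n : ℕ) : MvPolynomial ℕ ℝ :=
  Polynomial.aeval (X k : MvPolynomial ℕ ℝ) (Polynomial.hermite n)

/-- The multivariate Hermite polynomial `∏ₖ He_{βₖ}(yₖ)`. -/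
noncomputable def hermPoly (β : MultiIndex) : MvPolynomial ℕ ℝ := β.prod hermVar

theorem hermVar_zero (k : ℕ) : hermVar k 0 = 1 := by simp [hermVar]

theorem X_mul_hermVar (k n : ℕ) :
    X k * hermVar k n = hermVar k (n + 1) + (n : MvPolynomial ℕ ℝ) * hermVar k (n - 1) := by
  rw [hermVar, hermVar, hermVar, Polynomial.hermite_succ, derivative_hermite]
  simp

theorem eval_hermVar (y : ℕ → ℝ) (k n : ℕ) :
    eval y (hermVar k n) = Polynomial.aeval (y k) (Polynomial.hermite n) := by
  rw [hermVar, Polynomial.aeval_def, Polynomial.aeval_def, Polynomial.hom_eval₂]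
  congr 1
  · exact RingHom.ext_int _ _
  · simp

theorem eval_hermPoly (y : ℕ → ℝ) (β : MultiIndex) :
    eval y (hermPoly β) =
      ∏ k ∈ β.support, Polynomial.aeval (y k) (Polynomial.hermite (β k)) := by
  simp [hermPoly, Finsupp.prod, map_prod, eval_hermVar]

theorem hermPoly_zero : hermPoly 0 = 1 := by simp [hermPoly]

theorem hermPoly_eq_mul_erase (k : ℕ) (β : MultiIndex) :
    hermPoly β = hermVar k (β k) * hermPoly (β.erase k) :=
  (Finsupp.mul_prod_erase' β k hermVar hermVar_zero).symm

theorem erase_sub_single (β : MultiIndex) (k : ℕ) :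
    (β - Finsupp.single k 1).erase k = β.erase k := by
  ext i
  by_cases h : i = k
  · simp [h]
  · simp [Finsupp.erase_ne h, Ne.symm h]

theorem X_mul_hermPoly (k : ℕ) (β : MultiIndex) :
    X k * hermPoly β = hermPoly (β + Finsupp.single k 1) +
      (β k : ℝ) • hermPoly (β - Finsupp.single k 1) := by
  have h1 : (β + Finsupp.single k 1).erase k = β.erase k := by
    ext i
    by_cases h : i = k
    · simp [h]
    · simp [Finsupp.erase_ne h]
  rw [hermPoly_eq_mul_erase k β, hermPoly_eq_mul_erase k (β + Finsupp.single k 1),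
    hermPoly_eq_mul_erase k (β - Finsupp.single k 1), h1, erase_sub_single, ← mul_assoc,
    X_mul_hermVar, smul_eq_C_mul]
  simp
  ring

theorem span_hermPoly : Submodule.span ℝ (range hermPoly) = ⊤ := by
  rw [eq_top_iff]
  rintro p -
  induction p using MvPolynomial.induction_on with
  | C a =>
    have : (C a : MvPolynomial ℕ ℝ) = a • hermPoly 0 := by
      rw [hermPoly_zero, smul_eq_C_mul, mul_one]
    rw [this]
    exact Submodule.smul_mem _ _ (Submodule.subset_span ⟨0, rfl⟩)
  | add p q hp hq => exact Submodule.add_mem _ hp hq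
  | mul_X p k hp =>
    induction hp using Submodule.span_induction with
    | zero => simp
    | add p q _ _ hp hq => rw [add_mul]; exact Submodule.add_mem _ hp hq
    | smul r p _ hp => rw [smul_mul_assoc]; exact Submodule.smul_mem _ _ hp
    | mem p hp =>
      obtain ⟨β, rfl⟩ := hp
      rw [mul_comm, X_mul_hermPoly]
      exact Submodule.add_mem _ (Submodule.subset_span ⟨_, rfl⟩)
        (Submodule.smul_mem _ _ (Submodule.subset_span ⟨_, rfl⟩))

theorem noiseDeriv_hermVar (x : ℝ) (k n : ℕ) :
    noiseDeriv x (hermVar k n) =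
      C (n * cosFun k x) * hermVar k (n - 1) := by
  have h1 : ∀ m, hermVar k m = Polynomial.aeval (X k : MvPolynomial ℕ ℝ)
      ((Polynomial.hermite m).map (algebraMap ℤ ℝ)) := by
    intro m
    rw [Polynomial.aeval_map_algebraMap]
    rfl
  rw [h1 n, Derivation.map_aeval, Polynomial.derivative_map, derivative_hermite, noiseDeriv,
    mkDerivation_X, Polynomial.map_mul, map_mul, ← h1]
  simp
  ring

theorem noiseDeriv_hermPoly (x : ℝ) (β : MultiIndex) :
    noiseDeriv x (hermPoly β) = ∑ k ∈ β.support,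
      (β k * cosFun k x) • hermPoly (β - Finsupp.single k 1) := by
  rw [hermPoly, Finsupp.prod, derivation_prod]
  refine Finset.sum_congr rfl fun k _ => ?_
  have h3 : ∏ j ∈ β.support.erase k, hermVar j (β j) = hermPoly (β.erase k) := by
    rw [hermPoly, Finsupp.prod, Finsupp.support_erase]
    refine Finset.prod_congr rfl fun j hj => ?_
    rw [Finsupp.erase_ne (Finset.ne_of_mem_erase hj)]
  rw [h3, hermPoly_eq_mul_erase k (β - Finsupp.single k 1), erase_sub_single,
    noiseDeriv_hermVar, smul_eq_C_mul]
  simp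
  ring

/-- The normalizing factor `√β!`. -/
noncomputable def sqrtFactorial (β : MultiIndex) : ℝ := β.prod fun _ n => √(n.factorial : ℝ)

theorem sqrtFactorial_zero : sqrtFactorial 0 = 1 := by simp [sqrtFactorial]

theorem mul_sqrtFactorial_sub (β : MultiIndex) {k : ℕ} (hk : k ∈ β.support) :
    (β k : ℝ) * sqrtFactorial (β - Finsupp.single k 1) = sqrtFactorial β * √(β k : ℝ) := by
  have h1 : ∀ α : MultiIndex,
      sqrtFactorial α = √((α k).factorial : ℝ) * sqrtFactorial (α.erase k) :=
    fun α => (Finsupp.mul_prod_erase' α k _ (by simp)).symm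
  rw [h1 β, h1 (β - Finsupp.single k 1), erase_sub_single]
  obtain ⟨n, hn⟩ := Nat.exists_eq_succ_of_ne_zero (Finsupp.mem_support_iff.1 hk)
  have h3 : (β - Finsupp.single k 1 : MultiIndex) k = n := by simp [hn]
  rw [h3, hn, Nat.succ_eq_add_one, Nat.factorial_succ]
  push_cast
  rw [Real.sqrt_mul (by positivity)]
  have h4 : √((n : ℝ) + 1) * √((n : ℝ) + 1) = n + 1 := Real.mul_self_sqrt (by positivity)
  linear_combination (-(√(n.factorial : ℝ) * sqrtFactorial (β.erase k))) * h4

/-- The sequence of Gaussian random variables `W(mₖ)`. -/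
noncomputable def noise {Ω : Type*} (W : Lp ℝ 2 leb → Ω → ℝ) (ω : Ω) : ℕ → ℝ :=
  fun k => W (cosLp k) ω

theorem eval_hermPoly_noise {Ω : Type*} (W : Lp ℝ 2 leb → Ω → ℝ) (β : MultiIndex) (ω : Ω) :
    eval (noise W ω) (hermPoly β) = sqrtFactorial β * xi W β ω := by
  rw [eval_hermPoly, xi, sqrtFactorial, Finsupp.prod, ← Finset.prod_mul_distrib]
  refine Finset.prod_congr rfl fun k _ => ?_
  have : √((β k).factorial : ℝ) ≠ 0 :=
    (Real.sqrt_pos.2 (by exact_mod_cast Nat.factorial_pos _)).ne'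
  field_simp
  rfl

section Orthonormal

theorem integral_leb_eq (f : ℝ → ℝ) : ∫ x, f x ∂leb = ∫ x in (0)..Real.pi, f x := by
  rw [leb, intervalIntegral.integral_of_le Real.pi_pos.le, integral_Ioc_eq_integral_Ioo]

theorem inner_cosLp (j k : ℕ) :
    inner ℝ (cosLp j) (cosLp k) = ∫ x in (0)..Real.pi, cosFun j x * cosFun k x := by
  rw [L2.inner_def, ← integral_leb_eq]
  refine integral_congr_ae ?_
  filter_upwards [(memLp_cosFun j).coeFn_toLp, (memLp_cosFun k).coeFn_toLp] with x h1 h2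
  rw [cosLp, cosLp, h1, h2]
  simp [mul_comm]

theorem integral_cos_int {n : ℤ} (hn : n ≠ 0) : ∫ x in (0)..Real.pi, Real.cos (n * x) = 0 := by
  have hn' : (n : ℝ) ≠ 0 := by exact_mod_cast hn
  rw [intervalIntegral.integral_comp_mul_left (fun x => Real.cos x) hn', integral_cos]
  simp [Real.sin_int_mul_pi]

theorem inner_cosLp_of_ne {j k : ℕ} (h : j ≠ k) : inner ℝ (cosLp j) (cosLp k) = 0 := by
  rw [inner_cosLp]
  obtain ⟨r, hr⟩ := cosFun_eq j
  obtain ⟨s, hs⟩ := cosFun_eq k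
  have h1 : ∀ x, cosFun j x * cosFun k x = (r * s / 2) *
      (Real.cos (((j + k : ℤ) : ℝ) * x) + Real.cos (((j - k : ℤ) : ℝ) * x)) := by
    intro x
    rw [hr, hs]
    push_cast
    rw [add_mul, sub_mul, Real.cos_add, Real.cos_sub]
    ring
  simp only [h1]
  rw [intervalIntegral.integral_const_mul, intervalIntegral.integral_add
    (Continuous.intervalIntegrable (by fun_prop) _ _)
    (Continuous.intervalIntegrable (by fun_prop) _ _),
    integral_cos_int (by omega), integral_cos_int (by omega)]
  simp

theorem inner_cosLp_self (k : ℕ) : inner ℝ (cosLp k) (cosLp k) = 1 := by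
  rw [inner_cosLp]
  have hpi := Real.pi_pos
  by_cases hk : k = 0
  · simp only [cosFun, hk, if_true]
    rw [intervalIntegral.integral_const, div_mul_div_comm, Real.mul_self_sqrt hpi.le, smul_eq_mul,
      sub_zero]
    field_simp
  · simp only [cosFun, hk, if_false]
    have h1 : ∀ x : ℝ, √(2 / Real.pi) * Real.cos (k * x) * (√(2 / Real.pi) * Real.cos (k * x)) =
        (1 / Real.pi) * (1 + Real.cos (((2 * k : ℤ) : ℝ) * x)) := by
      intro x
      have h2 : √(2 / Real.pi) * √(2 / Real.pi) = 2 / Real.pi := Real.mul_self_sqrt (by positivity)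
      have h3 : ((2 * k : ℤ) : ℝ) * x = 2 * (k * x) := by push_cast; ring
      rw [h3, Real.cos_two_mul]
      linear_combination (Real.cos (k * x)) ^ 2 * h2
    simp only [h1]
    rw [intervalIntegral.integral_const_mul, intervalIntegral.integral_add
      (Continuous.intervalIntegrable (by fun_prop) _ _)
      (Continuous.intervalIntegrable (by fun_prop) _ _), integral_cos_int (by omega)]
    simp

end Orthonormal

section Hermite

theorem integral_hermite_gaussianReal {n : ℕ} (hn : n ≠ 0) :
    ∫ x, Polynomial.aeval x (Polynomial.hermite n) ∂(gaussianReal 0 1) = 0 := by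
  obtain ⟨m, rfl⟩ := Nat.exists_eq_succ_of_ne_zero hn
  rw [integral_gaussianReal_eq_integral_smul one_ne_zero]
  have hint : ∀ q : Polynomial ℤ,
      Integrable (fun x : ℝ => gaussianPDFReal 0 1 x • (Polynomial.aeval x q : ℝ)) := by
    intro q
    have h1 : ∀ n : ℕ, Integrable (fun x : ℝ => x ^ n) (gaussianReal 0 1) := by
      intro n
      have := (memLp_id_gaussianReal' (μ := 0) (v := 1) n (by simp)).integrable_norm_pow' 
      rw [← integrable_norm_iff (by fun_prop)]
      simpa using this
    have h2 : Integrable (fun x : ℝ => (Polynomial.aeval x q : ℝ)) (gaussianReal 0 1) := by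
      simp only [Polynomial.aeval_eq_sum_range]
      exact integrable_finsetSum _ fun i _ => (h1 i).smul (q.coeff i)
    rw [gaussianReal_of_var_ne_zero _ one_ne_zero, integrable_withDensity_iff_integrable_smul'
      (measurable_gaussianPDF _ _) (ae_of_all _ fun _ => gaussianPDF_lt_top)] at h2
    simpa [toReal_gaussianPDF] using h2
  have hd : ∀ x : ℝ, HasDerivAt
      (fun x : ℝ => -(gaussianPDFReal 0 1 x • (Polynomial.aeval x (Polynomial.hermite m) : ℝ)))
      (gaussianPDFReal 0 1 x • (Polynomial.aeval x (Polynomial.hermite (m + 1)) : ℝ)) x := by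
    intro x
    have h1 : HasDerivAt (gaussianPDFReal 0 1) (-x * gaussianPDFReal 0 1 x) x := by
      have h2 : gaussianPDFReal 0 1 = fun x => (√(2 * Real.pi * (1 : NNReal)))⁻¹ *
          Real.exp (-(x - 0) ^ 2 / (2 * (1 : NNReal))) := by
        rw [gaussianPDFReal_def]
      have h3 : HasDerivAt (fun x : ℝ => -(x - 0) ^ 2 / (2 * ((1 : NNReal) : ℝ))) (-x) x := by
        have := (((hasDerivAt_id x).sub_const 0).pow 2).neg.div_const (2 * ((1 : NNReal) : ℝ))
        refine this.congr_deriv ?_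
        simp
        ring
      rw [h2]
      have := (h3.exp).const_mul (√(2 * Real.pi * (1 : NNReal)))⁻¹
      refine this.congr_deriv ?_
      ring
    have h4 := (h1.mul (Polynomial.hasDerivAt_aeval (Polynomial.hermite m) x)).neg
    refine h4.congr_deriv ?_
    rw [Polynomial.hermite_succ]
    simp
    ring
  exact integral_eq_zero_of_hasDerivAt_of_integrable hd (hint _) (hint _).neg

end Hermite

section WhiteNoise

variable {Ω : Type*} [MeasurableSpace Ω] {P : Measure Ω}
  {W : Lp ℝ 2 leb → Ω → ℝ}

theorem IsWhiteNoise.hasGaussianLaw (hW : IsWhiteNoise P W) (h : Lp ℝ 2 leb) :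
    HasGaussianLaw (W h) P := ⟨hW.gaussian h⟩

theorem IsWhiteNoise.memLp (hW : IsWhiteNoise P W) (h : Lp ℝ 2 leb) {q : ℝ≥0∞} (hq : q ≠ ∞) :
    MemLp (W h) q P := (hW.hasGaussianLaw h).memLp hq

theorem IsWhiteNoise.integrable_exp (hW : IsWhiteNoise P W) (h : Lp ℝ 2 leb) (a : ℝ) :
    Integrable (fun ω => Real.exp (a * W h ω)) P := by
  have h1 := integrable_exp_mul_gaussianReal (μ := P[W h]) (v := Var[W h; P].toNNReal) a
  rw [← (hW.hasGaussianLaw h).map_eq_gaussianReal] at h1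
  exact h1.comp_measurable (hW.measurable h)

/-- The white noise as a map into `L₂(P)`. -/
noncomputable def IsWhiteNoise.toL2 (hW : IsWhiteNoise P W) (h : Lp ℝ 2 leb) : Lp ℝ 2 P :=
  (hW.memLp h (q := 2) (by simp)).toLp (W h)

theorem IsWhiteNoise.coeFn_toL2 (hW : IsWhiteNoise P W) (h : Lp ℝ 2 leb) :
    hW.toL2 h =ᵐ[P] W h := MemLp.coeFn_toLp _

theorem IsWhiteNoise.inner_toL2 (hW : IsWhiteNoise P W) (g h : Lp ℝ 2 leb) :
    inner ℝ (hW.toL2 g) (hW.toL2 h) = inner ℝ g h := by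
  rw [L2.inner_def, ← hW.covariance]
  refine integral_congr_ae ?_
  filter_upwards [hW.coeFn_toL2 g, hW.coeFn_toL2 h] with ω h1 h2
  rw [h1, h2]
  simp [mul_comm]

theorem IsWhiteNoise.toL2_add (hW : IsWhiteNoise P W) (g h : Lp ℝ 2 leb) :
    hW.toL2 (g + h) = hW.toL2 g + hW.toL2 h := by
  rw [← sub_eq_zero, ← inner_self_eq_zero (𝕜 := ℝ)]
  simp only [inner_sub_left, inner_sub_right, inner_add_left, inner_add_right, hW.inner_toL2]
  ring

theorem IsWhiteNoise.toL2_smul (hW : IsWhiteNoise P W) (a : ℝ) (h : Lp ℝ 2 leb) :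
    hW.toL2 (a • h) = a • hW.toL2 h := by
  rw [← sub_eq_zero, ← inner_self_eq_zero (𝕜 := ℝ)]
  simp only [inner_sub_left, inner_sub_right, real_inner_smul_left, real_inner_smul_right,
    hW.inner_toL2]
  ring

/-- The white noise as a linear isometry into `L₂(P)`. -/
noncomputable def IsWhiteNoise.isometry (hW : IsWhiteNoise P W) : Lp ℝ 2 leb →ₗᵢ[ℝ] Lp ℝ 2 P :=
  LinearMap.isometryOfInner
    { toFun := hW.toL2, map_add' := hW.toL2_add, map_smul' := hW.toL2_smul } hW.inner_toL2

theorem IsWhiteNoise.sum_ae (hW : IsWhiteNoise P W) {ι : Type*} (s : Finset ι) (a : ι → ℝ)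
    (h : ι → Lp ℝ 2 leb) : W (∑ i ∈ s, a i • h i) =ᵐ[P] fun ω => ∑ i ∈ s, a i * W (h i) ω := by
  have h1 : hW.toL2 (∑ i ∈ s, a i • h i) = ∑ i ∈ s, a i • hW.toL2 (h i) := by
    have := map_sum hW.isometry (fun i => a i • h i) s
    simp only [map_smul] at this
    exact this
  have h2 : ∀ᵐ ω ∂P, ∀ i ∈ s, hW.toL2 (h i) ω = W (h i) ω :=
    (Finset.eventually_all s).2 fun i _ => hW.coeFn_toL2 (h i)
  have h3 : ∀ᵐ ω ∂P, ∀ i ∈ s, (a i • hW.toL2 (h i) : Lp ℝ 2 P) ω = a i * hW.toL2 (h i) ω :=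
    (Finset.eventually_all s).2 fun i _ => Lp.coeFn_smul _ _
  filter_upwards [hW.coeFn_toL2 (∑ i ∈ s, a i • h i),
    Lp.coeFn_finsetSum s fun i => a i • hW.toL2 (h i), h2, h3] with ω e1 e2 e3 e4
  rw [← e1, h1, e2, Finset.sum_apply]
  exact Finset.sum_congr rfl fun i hi => by rw [e4 i hi, e3 i hi]

theorem IsWhiteNoise.hasGaussianLaw_pi (hW : IsWhiteNoise P W) {ι : Type*} [Fintype ι]
    (h : ι → Lp ℝ 2 leb) : HasGaussianLaw (fun ω i => W (h i) ω) P := by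
  classical
  refine ⟨isGaussian_of_isGaussian_map fun L => ?_⟩
  have hm : Measurable fun ω i => W (h i) ω := measurable_pi_lambda _ fun i => hW.measurable _
  rw [Measure.map_map L.measurable hm]
  have h1 : W (∑ i, L (Pi.single i 1) • h i) =ᵐ[P] L ∘ fun ω i => W (h i) ω := by
    filter_upwards [hW.sum_ae Finset.univ (fun i => L (Pi.single i 1)) h] with ω hω
    rw [hω, Function.comp_apply, ← L.coe_coe, LinearMap.pi_apply_eq_sum_univ L.toLinearMap]
    refine Finset.sum_congr rfl fun i _ => ?_
    rw [smul_eq_mul, mul_comm]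
    congr 2
    funext j
    simp [Pi.single_apply, eq_comm]
  rw [← Measure.map_congr h1]
  exact hW.gaussian _

theorem IsWhiteNoise.map_cosLp (hW : IsWhiteNoise P W) (k : ℕ) :
    P.map (W (cosLp k)) = gaussianReal 0 1 := by
  rw [(hW.hasGaussianLaw _).map_eq_gaussianReal, hW.mean]
  congr 1
  rw [variance_of_integral_eq_zero (hW.measurable _).aemeasurable (hW.mean _)]
  have h1 := hW.covariance (cosLp k) (cosLp k)
  rw [inner_cosLp_self] at h1
  simp only [sq, h1]
  simp

variable [IsProbabilityMeasure P]

theorem IsWhiteNoise.integral_hermPoly (hW : IsWhiteNoise P W) {β : MultiIndex} (hβ : β ≠ 0) :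
    ∫ ω, eval (noise W ω) (hermPoly β) ∂P = 0 := by
  have hind : iIndepFun (fun (i : β.support) => W (cosLp i)) P := by
    refine (hW.hasGaussianLaw_pi fun i : β.support => cosLp i).iIndepFun_of_covariance_eq_zero ?_
    intro i j hij
    rw [covariance_eq_sub (hW.memLp _ (by simp)) (hW.memLp _ (by simp)), hW.mean, zero_mul,
      sub_zero]
    have := hW.covariance (cosLp i) (cosLp j)
    rw [inner_cosLp_of_ne fun h => hij (Subtype.ext h)] at this
    exact this
  have hc : ∀ n : ℕ, Continuous fun x : ℝ => (Polynomial.aeval x (Polynomial.hermite n) : ℝ) :=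
    fun n => Polynomial.continuous_aeval _
  have h1 : ∀ ω, eval (noise W ω) (hermPoly β) = ∏ i : β.support,
      (Polynomial.aeval (W (cosLp i) ω) (Polynomial.hermite (β i)) : ℝ) := by
    intro ω
    rw [eval_hermPoly, ← Finset.prod_coe_sort β.support]
    rfl
  simp only [h1]
  rw [hind.integral_fun_prod_comp (fun i => (hW.measurable _).aemeasurable)
    (f := fun (i : β.support) x => (Polynomial.aeval x (Polynomial.hermite (β i)) : ℝ))
    (fun i => (hc _).aestronglyMeasurable)]
  obtain ⟨k, hk⟩ := Finsupp.support_nonempty_iff.2 hβ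
  refine Finset.prod_eq_zero (Finset.mem_univ ⟨k, hk⟩) ?_
  rw [← integral_hermite_gaussianReal (Finsupp.mem_support_iff.1 hk), ← hW.map_cosLp k,
    integral_map (hW.measurable _).aemeasurable (hc _).aestronglyMeasurable]

theorem IsWhiteNoise.memLp_eval (hW : IsWhiteNoise P W) (p : MvPolynomial ℕ ℝ) :
    ∀ n : ℕ, n ≠ 0 → MemLp (fun ω => eval (noise W ω) p) n P := by
  induction p using MvPolynomial.induction_on with
  | C a =>
    intro n _
    simpa using memLp_const a
  | add p q hp hq =>
    intro n hn
    simp only [map_add]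
    exact (hp n hn).add (hq n hn)
  | mul_X p i hp =>
    intro n hn
    simp only [map_mul, eval_X]
    have h1 := hp (2 * n) (by omega)
    have h2 : MemLp (fun ω => noise W ω i) ((2 * n : ℕ) : ℝ≥0∞) P :=
      hW.memLp (cosLp i) (ENNReal.natCast_ne_top _)
    have : ENNReal.HolderTriple ((2 * n : ℕ) : ℝ≥0∞) ((2 * n : ℕ) : ℝ≥0∞) n := by
      constructor
      rw [Nat.cast_mul, ENNReal.mul_inv (by simp) (by simp), ← add_mul]
      simp [ENNReal.inv_two_add_inv_two]
    exact h2.mul' h1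

end WhiteNoise

section Pairing

variable {Ω : Type*} [MeasurableSpace Ω] {P : Measure Ω} [IsProbabilityMeasure P]
  {W : Lp ℝ 2 leb → Ω → ℝ}

theorem IsWhiteNoise.integrable_mul_eval (hW : IsWhiteNoise P W) {η : Ω → ℝ} (hη : MemLp η 2 P)
    (p : MvPolynomial ℕ ℝ) : Integrable (fun ω => η ω * eval (noise W ω) p) P :=
  hη.integrable_mul (by exact_mod_cast hW.memLp_eval p 2 two_ne_zero)

open Classical in
/-- The linear functional `p ↦ E (η p(W(m₀), W(m₁), …))`. -/
noncomputable def IsWhiteNoise.pairing (hW : IsWhiteNoise P W) (η : Ω → ℝ) :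
    MvPolynomial ℕ ℝ →ₗ[ℝ] ℝ :=
  if hη : MemLp η 2 P then
    { toFun := fun p => ∫ ω, η ω * eval (noise W ω) p ∂P
      map_add' := fun p q => by
        simp only [map_add, mul_add]
        exact integral_add (hW.integrable_mul_eval hη p) (hW.integrable_mul_eval hη q)
      map_smul' := fun r p => by
        simp only [smul_eval, RingHom.id_apply, smul_eq_mul]
        rw [← integral_const_mul]
        congr 1
        funext ω
        ring }
  else 0

theorem IsWhiteNoise.pairing_apply (hW : IsWhiteNoise P W) {η : Ω → ℝ} (hη : MemLp η 2 P)
    (p : MvPolynomial ℕ ℝ) : hW.pairing η p = ∫ ω, η ω * eval (noise W ω) p ∂P := by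
  rw [IsWhiteNoise.pairing, dif_pos hη]
  rfl

/-- The functional `f ↦ ∫₀^π E (u(t, x) f(x)(W(m₀), W(m₁), …)) dx`. -/
noncomputable def IsWhiteNoise.slicePairing (hW : IsWhiteNoise P W) (u : ℝ → ℝ → Ω → ℝ) (t : ℝ)
    (f : ℝ → MvPolynomial ℕ ℝ) : ℝ :=
  ∫ x in (0)..Real.pi, hW.pairing (u t x) (f x)

/-- The functions `f` for which `slicePairing` is meaningful. -/
def IsWhiteNoise.pairingDomain (hW : IsWhiteNoise P W) (T : ℝ) (u : ℝ → ℝ → Ω → ℝ) :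
    Submodule ℝ (ℝ → MvPolynomial ℕ ℝ) where
  carrier := {f | (∀ t ∈ Icc 0 T,
      IntervalIntegrable (fun x => hW.pairing (u t x) (f x)) volume 0 Real.pi) ∧
    IntegrableOn (fun t => hW.slicePairing u t f) (Icc 0 T)}
  zero_mem' := by
    refine ⟨fun t _ => ?_, ?_⟩
    · simp
    · simp [slicePairing]
  add_mem' := by
    rintro f g ⟨hf1, hf2⟩ ⟨hg1, hg2⟩
    refine ⟨fun t ht => ?_, ?_⟩
    · simpa only [Pi.add_apply, map_add] using (hf1 t ht).add (hg1 t ht)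
    · refine (hf2.add hg2).congr_fun (fun t ht => ?_) measurableSet_Icc
      simp only [slicePairing, Pi.add_apply, map_add]
      exact (intervalIntegral.integral_add (hf1 t ht) (hg1 t ht)).symm
  smul_mem' := by
    rintro r f ⟨hf1, hf2⟩
    refine ⟨fun t ht => ?_, ?_⟩
    · simp only [Pi.smul_apply, map_smul]
      exact (hf1 t ht).smul r
    · refine IntegrableOn.congr_fun (hf2.smul r) (fun t ht => ?_) measurableSet_Icc
      simp only [slicePairing, Pi.smul_apply, map_smul]
      exact (intervalIntegral.integral_smul _ _).symm

theorem IsWhiteNoise.slicePairing_add (hW : IsWhiteNoise P W) {T : ℝ} {u : ℝ → ℝ → Ω → ℝ}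
    {f g : ℝ → MvPolynomial ℕ ℝ} (hf : f ∈ hW.pairingDomain T u) (hg : g ∈ hW.pairingDomain T u)
    {t : ℝ} (ht : t ∈ Icc 0 T) :
    hW.slicePairing u t (f + g) = hW.slicePairing u t f + hW.slicePairing u t g := by
  simp only [slicePairing, Pi.add_apply, map_add]
  exact intervalIntegral.integral_add (hf.1 t ht) (hg.1 t ht)

theorem IsWhiteNoise.slicePairing_smul (hW : IsWhiteNoise P W) (u : ℝ → ℝ → Ω → ℝ) (r : ℝ)
    (f : ℝ → MvPolynomial ℕ ℝ) (t : ℝ) :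
    hW.slicePairing u t (r • f) = r • hW.slicePairing u t f := by
  simp only [slicePairing, Pi.smul_apply, map_smul]
  exact intervalIntegral.integral_smul _ _

theorem IsWhiteNoise.slicePairing_zero (hW : IsWhiteNoise P W) (u : ℝ → ℝ → Ω → ℝ) (t : ℝ) :
    hW.slicePairing u t 0 = 0 := by
  simp [slicePairing]

/-- The pairs `(f, g)` such that `slicePairing` at `g` is the time derivative of `slicePairing`
at `f`, in integrated form. -/
def IsWhiteNoise.propagatedPairs (hW : IsWhiteNoise P W) (T : ℝ) (u : ℝ → ℝ → Ω → ℝ) :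
    Submodule ℝ ((ℝ → MvPolynomial ℕ ℝ) × (ℝ → MvPolynomial ℕ ℝ)) where
  carrier := {F | F.1 ∈ hW.pairingDomain T u ∧ F.2 ∈ hW.pairingDomain T u ∧ ∀ t ∈ Icc 0 T,
    hW.slicePairing u t F.1 =
      hW.slicePairing u 0 F.1 + ∫ s in (0)..t, hW.slicePairing u s F.2}
  zero_mem' := by
    refine ⟨Submodule.zero_mem _, Submodule.zero_mem _, fun t _ => ?_⟩
    simp [slicePairing_zero]
  add_mem' := by
    rintro F G ⟨hF1, hF2, hF⟩ ⟨hG1, hG2, hG⟩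
    refine ⟨Submodule.add_mem _ hF1 hG1, Submodule.add_mem _ hF2 hG2, fun t ht => ?_⟩
    have hT : (0 : ℝ) ∈ Icc 0 T := ⟨le_rfl, ht.1.trans ht.2⟩
    have hi : ∀ g ∈ hW.pairingDomain T u,
        IntervalIntegrable (fun s => hW.slicePairing u s g) volume 0 t := fun g hg => by
      rw [intervalIntegrable_iff_integrableOn_Icc_of_le ht.1]
      exact hg.2.mono_set (Icc_subset_Icc_right ht.2)
    have h1 : ∫ s in (0)..t, hW.slicePairing u s (F + G).2 =
        (∫ s in (0)..t, hW.slicePairing u s F.2) + ∫ s in (0)..t, hW.slicePairing u s G.2 := by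
      rw [← intervalIntegral.integral_add (hi _ hF2) (hi _ hG2)]
      refine intervalIntegral.integral_congr fun s hs => ?_
      rw [uIcc_of_le ht.1] at hs
      exact hW.slicePairing_add hF2 hG2 ⟨hs.1, hs.2.trans ht.2⟩
    rw [h1, Prod.fst_add, hW.slicePairing_add hF1 hG1 ht, hW.slicePairing_add hF1 hG1 hT, hF t ht,
      hG t ht]
    ring
  smul_mem' := by
    rintro r F ⟨hF1, hF2, hF⟩
    refine ⟨Submodule.smul_mem _ r hF1, Submodule.smul_mem _ r hF2, fun t ht => ?_⟩
    simp only [Prod.smul_fst, Prod.smul_snd, slicePairing_smul]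
    rw [hF t ht, intervalIntegral.integral_smul, smul_add]

end Pairing

section Propagator

variable {Ω : Type*} [MeasurableSpace Ω] {P : Measure Ω} [IsProbabilityMeasure P]
  {W : Lp ℝ 2 leb → Ω → ℝ} {T : ℝ} {u₀ : ℝ → ℝ} {u : ℝ → ℝ → Ω → ℝ}
  {U : MultiIndex → ℝ → ℝ → ℝ}

/-- The functions `U` are the chaos coefficients of `u`. -/
def IsChaosExpansion (P : Measure Ω) (W : Lp ℝ 2 leb → Ω → ℝ) (T : ℝ) (u : ℝ → ℝ → Ω → ℝ)
    (U : MultiIndex → ℝ → ℝ → ℝ) : Prop :=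
  ∀ t ∈ Icc 0 T, ∀ x ∈ Icc 0 Real.pi,
    InL2W P W (u t x) ∧ ∀ α, ∫ ω, u t x ω * xi W α ω ∂P = U α t x

theorem IsWhiteNoise.pairing_hermPoly (hW : IsWhiteNoise P W) (hu : IsChaosExpansion P W T u U)
    {t x : ℝ} (ht : t ∈ Icc 0 T) (hx : x ∈ Icc 0 Real.pi) (β : MultiIndex) :
    hW.pairing (u t x) (hermPoly β) = sqrtFactorial β * U β t x := by
  obtain ⟨h1, h2⟩ := hu t ht x hx
  rw [hW.pairing_apply h1.2, ← h2 β, ← integral_const_mul]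
  refine integral_congr_ae (Eventually.of_forall fun ω => ?_)
  simp only [eval_hermPoly_noise]
  ring

theorem IsWhiteNoise.slicePairing_smul_hermPoly (hW : IsWhiteNoise P W)
    (hu : IsChaosExpansion P W T u U) {t : ℝ} (ht : t ∈ Icc 0 T) (φ : ℝ → ℝ) (β : MultiIndex) :
    hW.slicePairing u t (fun x => φ x • hermPoly β) =
      sqrtFactorial β * ∫ x in (0)..Real.pi, U β t x * φ x := by
  rw [slicePairing, ← intervalIntegral.integral_const_mul]
  refine intervalIntegral.integral_congr fun x hx => ?_
  rw [uIcc_of_le Real.pi_pos.le] at hx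
  simp only [map_smul, hW.pairing_hermPoly hu ht hx, smul_eq_mul]
  ring

theorem IsChaosSolution.intervalIntegrable (hU : IsChaosSolution T u₀ U)
    (hu₀ : Integrable u₀ leb) (α : MultiIndex) {t : ℝ} (ht : t ∈ Icc 0 T) :
    IntervalIntegrable (fun x => U α t x) volume 0 Real.pi := by
  rcases eq_or_lt_of_le ht.1 with rfl | h0
  · have h1 : IntervalIntegrable (fun x => if α = 0 then u₀ x else 0) volume 0 Real.pi := by
      split_ifs
      · rw [intervalIntegrable_iff_integrableOn_Ioo_of_le Real.pi_pos.le]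
        exact hu₀
      · simp
    refine h1.congr fun x hx => ?_
    rw [uIoc_of_le Real.pi_pos.le] at hx
    exact (hU.initial α x (Ioc_subset_Icc_self hx)).symm
  · refine ContinuousOn.intervalIntegrable_of_Icc Real.pi_pos.le ?_
    exact (hU.continuousOn α).comp (f := fun x : ℝ => (t, x)) (by fun_prop)
      fun x hx => ⟨⟨h0, ht.2⟩, hx⟩

theorem IsWhiteNoise.smul_hermPoly_mem_pairingDomain (hW : IsWhiteNoise P W)
    (hU : IsChaosSolution T u₀ U) (hu₀ : Integrable u₀ leb) (hu : IsChaosExpansion P W T u U)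
    {φ : ℝ → ℝ} (hφ : Continuous φ) (β : MultiIndex) :
    (fun x => φ x • hermPoly β) ∈ hW.pairingDomain T u := by
  refine ⟨fun t ht => ?_, ?_⟩
  · have h1 : IntervalIntegrable (fun x => U β t x * (sqrtFactorial β * φ x)) volume 0 Real.pi :=
      (hU.intervalIntegrable hu₀ β ht).mul_continuousOn (by fun_prop)
    refine h1.congr fun x hx => ?_
    rw [uIoc_of_le Real.pi_pos.le] at hx
    simp only [map_smul, hW.pairing_hermPoly hu ht (Ioc_subset_Icc_self hx), smul_eq_mul]
    ring
  · rw [integrableOn_Icc_iff_integrableOn_Ioc]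
    have h1 : IntegrableOn (fun t => sqrtFactorial β * ∫ x in (0)..Real.pi, U β t x * φ x)
        (Ioc 0 T) := by
      refine Integrable.const_mul ?_ _
      have h2 := hU.integrableOn β
      rw [Measure.volume_eq_prod, IntegrableOn, ← Measure.prod_restrict] at h2
      obtain ⟨M, hM⟩ := (isCompact_Icc (a := 0) (b := Real.pi)).exists_bound_of_continuousOn
        hφ.continuousOn
      have h3 : Integrable (fun z : ℝ × ℝ => U β z.1 z.2 * φ z.2)
          ((volume.restrict (Ioc 0 T)).prod (volume.restrict (Icc 0 Real.pi))) := by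
        refine h2.mul_bdd (c := M) (by fun_prop) ?_
        rw [Measure.prod_restrict, ae_restrict_iff' (measurableSet_Ioc.prod measurableSet_Icc)]
        exact Eventually.of_forall fun z hz => hM _ hz.2
      have h4 := h3.integral_prod_left
      refine h4.congr (Eventually.of_forall fun t => ?_)
      simp only
      rw [intervalIntegral.integral_of_le Real.pi_pos.le, integral_Icc_eq_integral_Ioc]
    refine h1.congr_fun (fun t ht => ?_) measurableSet_Ioc
    exact (hW.slicePairing_smul_hermPoly hu (Ioc_subset_Icc_self ht) φ β).symm

theorem IsWhiteNoise.propagatedPairs_hermPoly (hW : IsWhiteNoise P W)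
    (hU : IsChaosSolution T u₀ U) (hu₀ : Integrable u₀ leb) (hu : IsChaosExpansion P W T u U)
    (j : ℤ) (β : MultiIndex) :
    ((fun x => Real.cos (j * x) • hermPoly β, fun x =>
      (-(j : ℝ) ^ 2 * Real.cos (j * x)) • hermPoly β +
        Real.cos (j * x) • noiseDeriv x (hermPoly β)) :
      (ℝ → MvPolynomial ℕ ℝ) × (ℝ → MvPolynomial ℕ ℝ)) ∈ hW.propagatedPairs T u := by
  have hd1 : deriv (fun x : ℝ => Real.cos (j * x)) = fun x => -(j : ℝ) * Real.sin (j * x) := by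
    funext x
    have := ((hasDerivAt_id x).const_mul (j : ℝ)).cos
    refine (this.congr_deriv ?_).deriv
    simp
    ring
  have hd2 : deriv (deriv fun x : ℝ => Real.cos (j * x)) =
      fun x => -(j : ℝ) ^ 2 * Real.cos (j * x) := by
    rw [hd1]
    funext x
    have := (((hasDerivAt_id x).const_mul (j : ℝ)).sin).const_mul (-(j : ℝ))
    refine (this.congr_deriv ?_).deriv
    simp
    ring
  have hg : ∀ x : ℝ, (-(j : ℝ) ^ 2 * Real.cos (j * x)) • hermPoly β +
      Real.cos (j * x) • noiseDeriv x (hermPoly β) =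
      (-(j : ℝ) ^ 2 * Real.cos (j * x)) • hermPoly β + ∑ k ∈ β.support,
        (Real.cos (j * x) * (β k * cosFun k x)) • hermPoly (β - Finsupp.single k 1) := by
    intro x
    rw [noiseDeriv_hermPoly, Finset.smul_sum]
    simp only [smul_smul]
  refine ⟨hW.smul_hermPoly_mem_pairingDomain hU hu₀ hu (by fun_prop) β, ?_, ?_⟩
  · simp only [hg]
    refine Submodule.add_mem _ (hW.smul_hermPoly_mem_pairingDomain hU hu₀ hu (by fun_prop) β) ?_
    have h1 : (fun x : ℝ => ∑ k ∈ β.support, (Real.cos (j * x) * (β k * cosFun k x)) •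
        hermPoly (β - Finsupp.single k 1)) = ∑ k ∈ β.support, fun x : ℝ =>
          (Real.cos (j * x) * (β k * cosFun k x)) • hermPoly (β - Finsupp.single k 1) := by
      funext x
      rw [Finset.sum_apply]
    rw [h1]
    refine Submodule.sum_mem _ fun k _ => hW.smul_hermPoly_mem_pairingDomain hU hu₀ hu ?_ _
    have := continuous_cosFun k
    fun_prop
  · intro t ht
    rcases eq_or_lt_of_le ht.1 with rfl | h0
    · simp
    have h0T : (0 : ℝ) ∈ Icc 0 T := ⟨le_rfl, ht.1.trans ht.2⟩
    have h1 := hU.propagator β (fun x => Real.cos (j * x)) (by fun_prop)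
      (by rw [hd1]; simp) (by rw [hd1]; simp [Real.sin_int_mul_pi]) t ⟨h0, ht.2⟩
    rw [hd2] at h1
    have h2 : ∀ s ∈ uIcc 0 t, hW.slicePairing u s (fun x =>
        (-(j : ℝ) ^ 2 * Real.cos (j * x)) • hermPoly β +
          Real.cos (j * x) • noiseDeriv x (hermPoly β)) = sqrtFactorial β *
        ∫ x in (0)..Real.pi, (U β s x * (-(j : ℝ) ^ 2 * Real.cos (j * x)) +
          source U β s x * Real.cos (j * x)) := by
      intro s hs
      rw [uIcc_of_le ht.1] at hs
      have hs' : s ∈ Icc 0 T := ⟨hs.1, hs.2.trans ht.2⟩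
      rw [slicePairing, ← intervalIntegral.integral_const_mul]
      refine intervalIntegral.integral_congr fun x hx => ?_
      rw [uIcc_of_le Real.pi_pos.le] at hx
      simp only [hg, map_add, map_sum, map_smul, hW.pairing_hermPoly hu hs' hx, smul_eq_mul]
      rw [mul_add, source, Finset.sum_mul, Finset.mul_sum]
      congr 1
      · ring
      · refine Finset.sum_congr rfl fun k hk => ?_
        linear_combination (Real.cos (j * x) * cosFun k x * U (β - Finsupp.single k 1) s x) *
          mul_sqrtFactorial_sub β hk
    rw [intervalIntegral.integral_congr h2, hW.slicePairing_smul_hermPoly hu ht,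
      hW.slicePairing_smul_hermPoly hu h0T, intervalIntegral.integral_const_mul, h1, mul_add]

theorem IsWhiteNoise.generatorGraph_le (hW : IsWhiteNoise P W)
    (hU : IsChaosSolution T u₀ U) (hu₀ : Integrable u₀ leb) (hu : IsChaosExpansion P W T u U) :
    generatorGraph ≤ hW.propagatedPairs T u := by
  refine Submodule.span_le.2 ?_
  rintro _ ⟨j, β, rfl⟩
  have key : ∀ p ∈ Submodule.span ℝ (range hermPoly), ((fun x => Real.cos (j * x) • p, fun x =>
      (-(j : ℝ) ^ 2 * Real.cos (j * x)) • p + Real.cos (j * x) • noiseDeriv x p) :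
      (ℝ → MvPolynomial ℕ ℝ) × (ℝ → MvPolynomial ℕ ℝ)) ∈ hW.propagatedPairs T u := by
    intro p hp
    induction hp using Submodule.span_induction with
    | mem p hp =>
      obtain ⟨α, rfl⟩ := hp
      exact hW.propagatedPairs_hermPoly hU hu₀ hu j α
    | zero =>
      convert Submodule.zero_mem (hW.propagatedPairs T u) using 1
      ext1
      · funext x; simp
      · funext x; simp
    | add p q _ _ hp hq =>
      convert Submodule.add_mem _ hp hq using 1
      ext1
      · funext x; simp [smul_add]
      · funext x
        simp only [map_add, smul_add, Prod.mk_add_mk, Pi.add_apply]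
        abel
    | smul r p _ hp =>
      convert Submodule.smul_mem _ r hp using 1
      ext1
      · funext x; simp [smul_comm r]
      · funext x
        simp only [Derivation.map_smul, Prod.smul_mk, Pi.smul_apply, smul_add, smul_comm r]
  have := key (monomial β 1) (by rw [span_hermPoly]; trivial)
  have h1 : cosMonomial j β = fun x => Real.cos (j * x) • monomial β 1 := by
    funext x
    simp [cosMonomial, smul_monomial]
  rw [h1]
  simp only [smul_eq_C_mul] at this ⊢
  exact this

theorem IsWhiteNoise.exists_generator (hW : IsWhiteNoise P W)
    (hU : IsChaosSolution T u₀ U) (hu₀ : Integrable u₀ leb) (hu : IsChaosExpansion P W T u U)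
    {N : ℕ} {f : ℝ → MvPolynomial ℕ ℝ} (hf : f ∈ cosSpace N) :
    ∃ g ∈ cosSpace N, (f, g) ∈ generatorGraph ∧ (f, g) ∈ hW.propagatedPairs T u := by
  obtain ⟨g, h1, h2⟩ := exists_generatorGraph hf
  exact ⟨g, h1, h2, hW.generatorGraph_le hU hu₀ hu h2⟩

theorem IsWhiteNoise.continuousOn_slicePairing (hW : IsWhiteNoise P W) (hT : 0 ≤ T)
    (hU : IsChaosSolution T u₀ U) (hu₀ : Integrable u₀ leb) (hu : IsChaosExpansion P W T u U)
    {N : ℕ} {f : ℝ → MvPolynomial ℕ ℝ} (hf : f ∈ cosSpace N) :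
    ContinuousOn (fun t => hW.slicePairing u t f) (Icc 0 T) := by
  obtain ⟨g, -, -, h⟩ := hW.exists_generator hU hu₀ hu hf
  have h1 : ContinuousOn (fun t => ∫ s in (0)..t, hW.slicePairing u s g) (Icc 0 T) := by
    have := intervalIntegral.continuousOn_primitive_interval (μ := volume) (a := 0) (b := T)
      (f := fun s => hW.slicePairing u s g) (by rw [uIcc_of_le hT]; exact h.2.1.2)
    rwa [uIcc_of_le hT] at this
  exact (continuousOn_const.add h1).congr fun t ht => h.2.2 t ht

theorem IsWhiteNoise.hasDerivWithinAt_slicePairing (hW : IsWhiteNoise P W) (hT : 0 ≤ T)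
    (hU : IsChaosSolution T u₀ U) (hu₀ : Integrable u₀ leb) (hu : IsChaosExpansion P W T u U)
    {N : ℕ} {f g : ℝ → MvPolynomial ℕ ℝ} (hg : g ∈ cosSpace N)
    (hfg : (f, g) ∈ hW.propagatedPairs T u) {t : ℝ} (ht : t ∈ Ico 0 T) :
    HasDerivWithinAt (fun t => hW.slicePairing u t f) (hW.slicePairing u t g) (Ici t) t := by
  have hc := hW.continuousOn_slicePairing hT hU hu₀ hu hg
  set H : ℝ → ℝ := IccExtend hT ((Icc 0 T).domRestrict fun s => hW.slicePairing u s g) with hH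
  have hHc : Continuous H := hc.domRestrict.Icc_extend'
  have hHe : ∀ s ∈ Icc 0 T, H s = hW.slicePairing u s g := fun s hs => IccExtend_of_mem hT _ hs
  have h1 : HasDerivAt (fun r => hW.slicePairing u 0 f + ∫ s in (0)..r, H s) (H t) t :=
    (hHc.integral_hasStrictDerivAt 0 t).hasDerivAt.const_add _
  have h2 : ∀ r ∈ Icc 0 T, hW.slicePairing u r f = hW.slicePairing u 0 f + ∫ s in (0)..r, H s := by
    intro r hr
    rw [hfg.2.2 r hr]
    congr 1
    refine intervalIntegral.integral_congr fun s hs => ?_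
    rw [uIcc_of_le hr.1] at hs
    exact (hHe s ⟨hs.1, hs.2.trans hr.2⟩).symm
  rw [← hHe t (Ico_subset_Icc_self ht)]
  refine h1.hasDerivWithinAt.congr_of_eventuallyEq ?_ (h2 t (Ico_subset_Icc_self ht))
  filter_upwards [self_mem_nhdsWithin, mem_nhdsWithin_of_mem_nhds (Iio_mem_nhds ht.2)] with r h3 h4
  exact h2 r ⟨ht.1.trans (mem_Ici.1 h3), (mem_Iio.1 h4).le⟩

theorem IsWhiteNoise.pairing_initial (hW : IsWhiteNoise P W) (hT : 0 ≤ T)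
    (hU : IsChaosSolution T u₀ U) (hu : IsChaosExpansion P W T u U) {x : ℝ}
    (hx : x ∈ Icc 0 Real.pi) (p : MvPolynomial ℕ ℝ) :
    hW.pairing (u 0 x) p = u₀ x * ∫ ω, eval (noise W ω) p ∂P := by
  have hint : ∀ p, Integrable (fun ω => eval (noise W ω) p) P := fun p => by
    have := hW.memLp_eval p 1 one_ne_zero
    rw [Nat.cast_one, memLp_one_iff_integrable] at this
    exact this
  have hp : p ∈ Submodule.span ℝ (range hermPoly) := by rw [span_hermPoly]; trivial
  induction hp using Submodule.span_induction with
  | zero => simp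
  | add p q _ _ hp hq =>
    simp only [map_add]
    rw [integral_add (hint p) (hint q), hp, hq, mul_add]
  | smul r p _ hp =>
    simp only [map_smul, smul_eval]
    rw [integral_const_mul, hp, smul_eq_mul]
    ring
  | mem p hp =>
    obtain ⟨β, rfl⟩ := hp
    rw [hW.pairing_hermPoly hu ⟨le_rfl, hT⟩ hx, hU.initial β x hx]
    by_cases hβ : β = 0
    · simp [hβ, sqrtFactorial_zero, hermPoly_zero]
    · simp [hβ, hW.integral_hermPoly hβ]

theorem IsWhiteNoise.slicePairing_nonneg (hW : IsWhiteNoise P W) (hT : 0 ≤ T)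
    (hU : IsChaosSolution T u₀ U) (hu₀ : Integrable u₀ leb)
    (hpos : ∀ x ∈ Icc 0 Real.pi, 0 ≤ u₀ x) (hu : IsChaosExpansion P W T u U)
    {N : ℕ} {f : ℝ → MvPolynomial ℕ ℝ} (hf : f ∈ cosSpace N) (hf' : f ∈ nonnegCone)
    {t : ℝ} (ht : t ∈ Icc 0 T) : 0 ≤ hW.slicePairing u t f := by
  have hdom : ∀ f ∈ cosSpace N, f ∈ hW.pairingDomain T u := fun f hf =>
    (hW.exists_generator hU hu₀ hu hf).choose_spec.2.2.1
  choose A hA using fun f : cosSpace N => hW.exists_generator hU hu₀ hu f.2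
  refine nonneg_of_flow_of_invariant (X := cosSpace N) (K := {f | f.1 ∈ nonnegCone})
    (A := fun f => ⟨A f, (hA f).1⟩) (G := fun h f => ⟨step h f, step_mem h f.2⟩)
    (c := fun t f => hW.slicePairing u t f) ?_ ?_ ?_ hT ?_ ?_ ?_ ?_ t ht ⟨f, hf⟩ hf'
  · intro f μ
    let ℓ : ℝ × (ℕ → ℝ) → Module.Dual ℝ (cosSpace N) := fun z =>
      ((aeval z.2 : MvPolynomial ℕ ℝ →ₐ[ℝ] ℝ).toLinearMap.comp (LinearMap.proj z.1)).comp
        (cosSpace N).subtype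
    have hℓ : ∀ z (f : cosSpace N), ℓ z f = eval z.2 (f.1 z.1) := fun z f => by
      simp [ℓ, aeval_eq_eval]
    have hsep : ∀ f : cosSpace N, (∀ z, ℓ z f = 0) → f = 0 := by
      intro f hf
      ext1
      funext x
      refine MvPolynomial.funext fun y => ?_
      have := hf (x, y)
      rw [hℓ] at this
      simpa using this
    have h1 := tendsto_dual_of_separating hsep (F := 𝓝[>] (0 : ℝ))
      (w := fun h => h⁻¹ • ((⟨step h f, step_mem h f.2⟩ : cosSpace N) - f))
      (w₀ := ⟨A f, (hA f).1⟩) (fun z => ?_) μ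
    · simpa only [map_smul, map_sub, smul_eq_mul] using h1
    · simp only [map_smul, map_sub, smul_eq_mul]
      simp only [hℓ]
      exact tendsto_step (hA f).2.1 z.1 z.2
  · intro h
    exact ⟨fun f g => Subtype.ext (step_add h _ _), fun r f => Subtype.ext (step_smul h r _)⟩
  · intro h _ f hf
    exact step_mem_nonnegCone h hf
  · intro t ht
    exact ⟨fun f g => hW.slicePairing_add (hdom f f.2) (hdom g g.2) ht,
      fun r f => hW.slicePairing_smul u r f t⟩
  · intro f
    exact hW.continuousOn_slicePairing hT hU hu₀ hu f.2
  · intro f t ht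
    exact hW.hasDerivWithinAt_slicePairing hT hU hu₀ hu (hA f).1 (hA f).2.2 ht
  · intro f hf
    refine intervalIntegral.integral_nonneg Real.pi_pos.le fun x hx => ?_
    rw [hW.pairing_initial hT hU hu hx]
    exact mul_nonneg (hpos x hx) (integral_nonneg fun ω => hf x _)

end Propagator

section CosineApproximation

/-- Uniform approximation on `[0, π]` by polynomials in `cos x`. -/
theorem exists_polynomial_cos_near {g : ℝ → ℝ} (hg : ContinuousOn g (Icc 0 Real.pi)) {ε : ℝ}
    (hε : 0 < ε) :
    ∃ q : Polynomial ℝ, ∀ x ∈ Icc 0 Real.pi, |q.eval (Real.cos x) - g x| < ε := by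
  have h1 : ContinuousOn (fun z => g (Real.arccos z)) (Icc (-1) 1) :=
    hg.comp Real.continuous_arccos.continuousOn
      fun z _ => ⟨Real.arccos_nonneg z, Real.arccos_le_pi z⟩
  obtain ⟨q, hq⟩ := exists_polynomial_near_of_continuousOn (-1) 1 _ h1 ε hε
  refine ⟨q, fun x hx => ?_⟩
  have := hq (Real.cos x) ⟨Real.neg_one_le_cos x, Real.cos_le_one x⟩
  rwa [Real.arccos_cos hx.1 hx.2] at this

/-- A continuous function on `[0, π]` is non-negative if its integrals against the squares of the
polynomials in `cos x` are. -/
theorem nonneg_of_integral_mul_cos_sq {F : ℝ → ℝ} (hF : ContinuousOn F (Icc 0 Real.pi))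
    (h : ∀ q : Polynomial ℝ, 0 ≤ ∫ x in (0)..Real.pi, F x * q.eval (Real.cos x) ^ 2) :
    ∀ x ∈ Icc 0 Real.pi, 0 ≤ F x := by
  set m : ℝ → ℝ := fun x => max (-F x) 0 with hm
  have hmc : ContinuousOn m (Icc 0 Real.pi) := hF.neg.sup continuousOn_const
  set g : ℝ → ℝ := fun x => √(m x) with hg
  have hgc : ContinuousOn g (Icc 0 Real.pi) := hmc.sqrt
  choose q hq using fun n : ℕ => exists_polynomial_cos_near hgc (Nat.one_div_pos_of_nat (n := n))
  obtain ⟨M, hM⟩ := isCompact_Icc.exists_bound_of_continuousOn hF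
  obtain ⟨B, hB⟩ := isCompact_Icc.exists_bound_of_continuousOn hgc
  have hsub : uIoc 0 Real.pi ⊆ Icc 0 Real.pi := by
    rw [uIoc_of_le Real.pi_pos.le]
    exact Ioc_subset_Icc_self
  have hlim : Tendsto (fun n => ∫ x in (0)..Real.pi, F x * (q n).eval (Real.cos x) ^ 2) atTop
      (𝓝 (∫ x in (0)..Real.pi, F x * g x ^ 2)) := by
    refine intervalIntegral.tendsto_integral_filter_of_dominated_convergence
      (fun _ => M * (B + 1) ^ 2) ?_ ?_ ?_ ?_
    · refine Eventually.of_forall fun n => ?_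
      refine ContinuousOn.aestronglyMeasurable ?_ measurableSet_uIoc
      refine (hF.mono hsub).mul (Continuous.continuousOn ?_)
      exact ((q n).continuous.comp Real.continuous_cos).pow 2
    · refine Eventually.of_forall fun n => Eventually.of_forall fun x hx => ?_
      have h1 := hq n x (hsub hx)
      have h2 := hB x (hsub hx)
      have h3 : 1 / ((n : ℝ) + 1) ≤ 1 := by
        rw [div_le_one (by positivity)]
        have : (0 : ℝ) ≤ n := n.cast_nonneg
        linarith
      have h4 : |(q n).eval (Real.cos x)| ≤ B + 1 := by
        have h5 := abs_sub_abs_le_abs_sub ((q n).eval (Real.cos x)) (g x)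
        rw [Real.norm_eq_abs] at h2
        linarith
      rw [norm_mul, norm_pow, Real.norm_eq_abs ((q n).eval _)]
      exact mul_le_mul (hM x (hsub hx)) (pow_le_pow_left₀ (abs_nonneg _) h4 2) (by positivity)
        ((norm_nonneg _).trans (hM x (hsub hx)))
    · simp
    · refine Eventually.of_forall fun x hx => ?_
      refine Tendsto.const_mul _ (Tendsto.pow ?_ 2)
      rw [tendsto_iff_dist_tendsto_zero]
      refine squeeze_zero (fun _ => dist_nonneg) (fun n => ?_)
        tendsto_one_div_add_atTop_nhds_zero_nat
      rw [Real.dist_eq]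
      exact (hq n x (hsub hx)).le
  have h0 : 0 ≤ ∫ x in (0)..Real.pi, F x * g x ^ 2 :=
    ge_of_tendsto' hlim fun n => h (q n)
  have h1 : ∀ x, F x * g x ^ 2 = -(m x ^ 2) := by
    intro x
    rw [hg, hm]
    dsimp only
    rw [Real.sq_sqrt (le_max_right _ _)]
    rcases le_total (-F x) 0 with h | h
    · rw [max_eq_right h]; ring
    · rw [max_eq_left h]; ring
  simp only [h1, intervalIntegral.integral_neg] at h0
  intro x hx
  by_contra hneg
  have hmx : 0 < m x := lt_max_of_lt_left (by linarith)
  have := intervalIntegral.integral_pos (f := fun x => m x ^ 2) Real.pi_pos (hmc.pow 2)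
    (fun x _ => sq_nonneg _) ⟨x, hx, by positivity⟩
  linarith

theorem exists_cosSpace_const (p : MvPolynomial ℕ ℝ) : ∃ N, (fun _ => p) ∈ cosSpace N := by
  induction p using MvPolynomial.monomial_add_induction_on with
  | C a => exact ⟨_, const_monomial_mem 0 a⟩
  | monomial_add a b f _ _ ih =>
    obtain ⟨N, hN⟩ := ih
    exact ⟨_, Submodule.add_mem _
      (cosSpace_mono (le_max_left _ N) (const_monomial_mem a b))
      (cosSpace_mono (le_max_right _ N) hN)⟩

theorem exists_cosSpace_polynomial (q : Polynomial ℝ) :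
    ∃ N, (fun x => C (q.eval (Real.cos x)) : ℝ → MvPolynomial ℕ ℝ) ∈ cosSpace N := by
  induction q using Polynomial.induction_on' with
  | add p q hp hq =>
    obtain ⟨M, hM⟩ := hp
    obtain ⟨N, hN⟩ := hq
    refine ⟨max M N, ?_⟩
    simp only [Polynomial.eval_add, map_add]
    exact Submodule.add_mem _ (cosSpace_mono (le_max_left _ _) hM)
      (cosSpace_mono (le_max_right _ _) hN)
  | monomial n a =>
    have h1 := pow_mem_cosSpace (cosMonomial_mem (j := 1) (β := 0) (N := 1) (by simp)) n
    have h2 : (fun x => C ((Polynomial.monomial n a).eval (Real.cos x)) :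
        ℝ → MvPolynomial ℕ ℝ) = a • cosMonomial 1 0 ^ n := by
      funext x
      simp [cosMonomial, smul_eq_C_mul]
    rw [h2]
    exact ⟨_, Submodule.smul_mem _ a h1⟩

end CosineApproximation

section Positivity

variable {Ω : Type*} [MeasurableSpace Ω] {P : Measure Ω} [IsProbabilityMeasure P]
  {W : Lp ℝ 2 leb → Ω → ℝ} {T : ℝ} {u₀ : ℝ → ℝ} {u : ℝ → ℝ → Ω → ℝ}
  {U : MultiIndex → ℝ → ℝ → ℝ}

theorem IsWhiteNoise.continuousOn_pairing (hW : IsWhiteNoise P W)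
    (hU : IsChaosSolution T u₀ U) (hu : IsChaosExpansion P W T u U) {t : ℝ} (ht : t ∈ Ioc 0 T)
    (p : MvPolynomial ℕ ℝ) :
    ContinuousOn (fun x => hW.pairing (u t x) p) (Icc 0 Real.pi) := by
  have hp : p ∈ Submodule.span ℝ (range hermPoly) := by rw [span_hermPoly]; trivial
  induction hp using Submodule.span_induction with
  | zero => simpa using continuousOn_const
  | add p q _ _ hp hq => simp only [map_add]; exact hp.add hq
  | smul r p _ hp => simp only [map_smul]; exact hp.const_smul r
  | mem p hp =>
    obtain ⟨β, rfl⟩ := hp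
    have h1 : ContinuousOn (fun x => U β t x) (Icc 0 Real.pi) :=
      (hU.continuousOn β).comp (f := fun x : ℝ => (t, x)) (by fun_prop) fun x hx => ⟨ht, hx⟩
    exact (h1.const_smul (sqrtFactorial β)).congr fun x hx =>
      hW.pairing_hermPoly hu (Ioc_subset_Icc_self ht) hx β

theorem IsWhiteNoise.pairing_sq_nonneg (hW : IsWhiteNoise P W)
    (hU : IsChaosSolution T u₀ U) (hu₀ : Integrable u₀ leb)
    (hpos : ∀ x ∈ Icc 0 Real.pi, 0 ≤ u₀ x) (hu : IsChaosExpansion P W T u U) {t x : ℝ}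
    (ht : t ∈ Icc 0 T) (hx : x ∈ Icc 0 Real.pi) (p : MvPolynomial ℕ ℝ) :
    0 ≤ hW.pairing (u t x) (p ^ 2) := by
  have hT : 0 ≤ T := ht.1.trans ht.2
  rcases eq_or_lt_of_le ht.1 with rfl | h0
  · rw [hW.pairing_initial hT hU hu hx]
    refine mul_nonneg (hpos x hx) (integral_nonneg fun ω => ?_)
    simpa using sq_nonneg _
  refine nonneg_of_integral_mul_cos_sq (hW.continuousOn_pairing hU hu ⟨h0, ht.2⟩ (p ^ 2))
    (fun q => ?_) x hx
  obtain ⟨M, hM⟩ := exists_cosSpace_const (p ^ 2)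
  obtain ⟨N, hN⟩ := exists_cosSpace_polynomial (q ^ 2)
  have h1 := hW.slicePairing_nonneg hT hU hu₀ hpos hu (mul_mem_cosSpace hN hM)
    (fun x y => ?_) ht
  · refine h1.trans_eq ?_
    rw [slicePairing]
    congr 1
    funext x
    rw [Pi.mul_apply, ← smul_eq_C_mul, map_smul, smul_eq_mul, Polynomial.eval_pow, mul_comm]
  · simp only [Pi.mul_apply, map_mul, eval_C, map_pow, Polynomial.eval_pow]
    positivity

end Positivity

section Completeness

theorem integrable_mul_of_continuous {f φ : ℝ → ℝ} (hf : Integrable f leb) (hφ : Continuous φ) :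
    Integrable (fun x => f x * φ x) leb := by
  obtain ⟨M, hM⟩ := (isCompact_Icc (a := 0) (b := Real.pi)).exists_bound_of_continuousOn
    hφ.continuousOn
  refine hf.mul_bdd (c := M) hφ.aestronglyMeasurable ?_
  rw [leb, ae_restrict_iff' measurableSet_Ioo]
  exact Eventually.of_forall fun x hx => hM x (Ioo_subset_Icc_self hx)

theorem integral_mul_cos_pow_eq_zero {f : ℝ → ℝ} (hf : Integrable f leb)
    (h : ∀ k, ∫ x, f x * cosFun k x ∂leb = 0) (n : ℕ) :
    ∀ j : ℤ, ∫ x, f x * (Real.cos x ^ n * Real.cos (j * x)) ∂leb = 0 := by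
  induction n with
  | zero =>
    intro j
    have hr : ∃ r : ℝ, ∀ x, Real.cos (j * x) = r * cosFun j.natAbs x := by
      have habs : ∀ x : ℝ, Real.cos (j * x) = Real.cos ((j.natAbs : ℝ) * x) := by
        intro x
        rw [Nat.cast_natAbs, Int.cast_abs]
        rcases abs_choice (j : ℝ) with h | h <;> rw [h]
        rw [neg_mul, Real.cos_neg]
      have hpi := Real.pi_pos
      by_cases hj : j.natAbs = 0
      · refine ⟨√Real.pi, fun x => ?_⟩
        rw [habs, hj]
        simp [cosFun, (Real.sqrt_pos.2 hpi).ne']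
      · refine ⟨(√(2 / Real.pi))⁻¹, fun x => ?_⟩
        have : √(2 / Real.pi) ≠ 0 := by positivity
        rw [habs, cosFun, if_neg hj]
        field_simp
    obtain ⟨r, hr⟩ := hr
    simp only [pow_zero, one_mul, hr]
    have : ∀ x, f x * (r * cosFun j.natAbs x) = r * (f x * cosFun j.natAbs x) := fun x => by ring
    simp only [this]
    rw [integral_const_mul, h, mul_zero]
  | succ n ih =>
    intro j
    have h1 : ∀ x : ℝ, f x * (Real.cos x ^ (n + 1) * Real.cos (j * x)) =
        (1 / 2) * (f x * (Real.cos x ^ n * Real.cos (((j + 1 : ℤ) : ℝ) * x)) +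
          f x * (Real.cos x ^ n * Real.cos (((j - 1 : ℤ) : ℝ) * x))) := by
      intro x
      push_cast
      rw [add_mul, sub_mul, one_mul, Real.cos_add, Real.cos_sub]
      ring
    simp only [h1]
    rw [integral_const_mul, integral_add (integrable_mul_of_continuous hf (by fun_prop))
      (integrable_mul_of_continuous hf (by fun_prop)), ih, ih]
    simp

theorem integral_mul_polynomial_cos_eq_zero {f : ℝ → ℝ} (hf : Integrable f leb)
    (h : ∀ k, ∫ x, f x * cosFun k x ∂leb = 0) (q : Polynomial ℝ) :
    ∫ x, f x * q.eval (Real.cos x) ∂leb = 0 := by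
  have h1 : ∀ x, f x * q.eval (Real.cos x) =
      ∑ i ∈ Finset.range (q.natDegree + 1), q.coeff i * (f x * (Real.cos x ^ i *
        Real.cos (((0 : ℤ) : ℝ) * x))) := by
    intro x
    rw [Polynomial.eval_eq_sum_range, Finset.mul_sum]
    refine Finset.sum_congr rfl fun i _ => ?_
    simp
    ring
  simp only [h1]
  rw [integral_finsetSum _ fun i _ =>
    (integrable_mul_of_continuous hf (by fun_prop)).const_mul _]
  refine Finset.sum_eq_zero fun i _ => ?_
  rw [integral_const_mul, integral_mul_cos_pow_eq_zero hf h, mul_zero]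

theorem ae_eq_zero_of_integral_mul_cosFun {f : ℝ → ℝ} (hf : Integrable f leb)
    (h : ∀ k, ∫ x, f x * cosFun k x ∂leb = 0) : ∀ᵐ x ∂leb, f x = 0 := by
  refine ae_eq_zero_of_integral_contDiff_smul_eq_zero hf.locallyIntegrable fun g hg _ => ?_
  have hgc : Continuous g := hg.continuous
  have hbound : ∀ ε > 0, |∫ x, f x * g x ∂leb| ≤ ε * ∫ x, |f x| ∂leb := by
    intro ε hε
    obtain ⟨q, hq⟩ := exists_polynomial_cos_near hgc.continuousOn hε
    have hqc : Continuous fun x => q.eval (Real.cos x) := q.continuous.comp Real.continuous_cos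
    have h1 : ∫ x, f x * g x ∂leb = ∫ x, f x * (g x - q.eval (Real.cos x)) ∂leb := by
      simp only [mul_sub]
      rw [integral_sub (integrable_mul_of_continuous hf hgc) (integrable_mul_of_continuous hf hqc),
        integral_mul_polynomial_cos_eq_zero hf h, sub_zero]
    rw [h1, ← Real.norm_eq_abs, ← integral_const_mul]
    refine norm_integral_le_of_norm_le (hf.abs.const_mul ε) ?_
    rw [leb, ae_restrict_iff' measurableSet_Ioo]
    refine Eventually.of_forall fun x hx => ?_
    rw [norm_mul, Real.norm_eq_abs, Real.norm_eq_abs, mul_comm, abs_sub_comm]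
    exact mul_le_mul_of_nonneg_right (hq x (Ioo_subset_Icc_self hx)).le (abs_nonneg _)
  have h2 : |∫ x, f x * g x ∂leb| ≤ 0 := by
    have h3 : Tendsto (fun ε : ℝ => ε * ∫ x, |f x| ∂leb) (𝓝[>] 0) (𝓝 (0 * ∫ x, |f x| ∂leb)) :=
      (tendsto_id.mono_left nhdsWithin_le_nhds).mul_const _
    rw [zero_mul] at h3
    refine ge_of_tendsto h3 ?_
    filter_upwards [self_mem_nhdsWithin] with ε hε
    exact hbound ε hε
  have h4 := abs_nonpos_iff.1 h2
  simpa only [smul_eq_mul, mul_comm] using h4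

theorem topologicalClosure_span_cosLp :
    (Submodule.span ℝ (range cosLp)).topologicalClosure = ⊤ := by
  rw [Submodule.topologicalClosure_eq_top_iff, eq_bot_iff]
  intro f hf
  rw [Submodule.mem_bot]
  have hfi : Integrable f leb := (Lp.memLp f).integrable (by norm_num)
  have h1 : ∀ k, ∫ x, f x * cosFun k x ∂leb = 0 := by
    intro k
    have h2 := (Submodule.mem_orthogonal _ _).1 hf (cosLp k) (Submodule.subset_span ⟨k, rfl⟩)
    rw [L2.inner_def] at h2
    rw [← h2]
    refine integral_congr_ae ?_
    filter_upwards [(memLp_cosFun k).coeFn_toLp] with x h3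
    rw [cosLp, h3]
    simp
  refine (Lp.eq_zero_iff_ae_eq_zero).2 ?_
  exact ae_eq_zero_of_integral_mul_cosFun hfi h1

end Completeness

section Determinacy

variable {Ω : Type*} [MeasurableSpace Ω] {P : Measure Ω} {W : Lp ℝ 2 leb → Ω → ℝ}

theorem IsWhiteNoise.memLp_exp (hW : IsWhiteNoise P W) (h : Lp ℝ 2 leb) (a : ℝ) :
    MemLp (fun ω => Real.exp (a * W h ω)) 2 P := by
  have hm := hW.measurable h
  rw [memLp_two_iff_integrable_sq (by fun_prop)]
  refine (hW.integrable_exp h (2 * a)).congr (Eventually.of_forall fun ω => ?_)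
  simp only [← Real.exp_nat_mul]
  congr 1
  push_cast
  ring

theorem integrable_withDensity_abs_iff {η g : Ω → ℝ} (hη : Measurable η) :
    Integrable g (P.withDensity fun ω => ENNReal.ofReal |η ω|) ↔
      Integrable (fun ω => |η ω| * g ω) P := by
  rw [integrable_withDensity_iff_integrable_smul' (by fun_prop) (by simp)]
  simp

theorem integral_withDensity_abs {η : Ω → ℝ} (hη : Measurable η) (g : Ω → ℝ) :
    ∫ ω, g ω ∂(P.withDensity fun ω => ENNReal.ofReal |η ω|) = ∫ ω, |η ω| * g ω ∂P := by
  rw [integral_withDensity_eq_integral_toReal_smul (by fun_prop) (by simp)]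
  simp

theorem IsWhiteNoise.integral_cexp_eq_zero (hW : IsWhiteNoise P W) {ν : Measure Ω}
    (hν : ν ≪ P) {f : Ω → ℝ} (hf : Integrable f ν)
    (hspan : ∀ h ∈ Submodule.span ℝ (range cosLp),
      ∫ ω, (f ω : ℂ) * Complex.exp (W h ω * Complex.I) ∂ν = 0) (h : Lp ℝ 2 leb) :
    ∫ ω, (f ω : ℂ) * Complex.exp (W h ω * Complex.I) ∂ν = 0 := by
  have hcl : h ∈ closure (Submodule.span ℝ (range cosLp) : Set (Lp ℝ 2 leb)) := by
    rw [← Submodule.topologicalClosure_coe, topologicalClosure_span_cosLp]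
    trivial
  obtain ⟨g, hg, hlim⟩ := mem_closure_iff_seq_limit.1 hcl
  have h1 : Tendsto (fun n => hW.isometry (g n)) atTop (𝓝 (hW.isometry h)) :=
    (hW.isometry.continuous.tendsto h).comp hlim
  obtain ⟨ns, hns, hae⟩ := (tendstoInMeasure_of_tendsto_Lp h1).exists_seq_tendsto_ae
  have h2 : ∀ᵐ ω ∂ν, Tendsto (fun n => W (g (ns n)) ω) atTop (𝓝 (W h ω)) := by
    refine hν.ae_le ?_
    have h3 : ∀ᵐ ω ∂P, ∀ n, hW.toL2 (g (ns n)) ω = W (g (ns n)) ω :=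
      ae_all_iff.2 fun n => hW.coeFn_toL2 _
    filter_upwards [hae, h3, hW.coeFn_toL2 h] with ω e1 e2 e3
    rw [← e3]
    exact e1.congr e2
  refine tendsto_nhds_unique (tendsto_integral_of_dominated_convergence
    (F := fun n ω => (f ω : ℂ) * Complex.exp (W (g (ns n)) ω * Complex.I)) (fun ω => |f ω|)
    ?_ hf.abs ?_ ?_) ?_
  · intro n
    have hm := hW.measurable (g (ns n))
    exact (Complex.continuous_ofReal.comp_aestronglyMeasurable hf.1).mul (by fun_prop)
  · intro n
    refine Eventually.of_forall fun ω => ?_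
    rw [norm_mul, Complex.norm_exp_ofReal_mul_I, mul_one, Complex.norm_real, Real.norm_eq_abs]
  · filter_upwards [h2] with ω hω
    refine Tendsto.const_mul _ ?_
    have hc : Continuous fun x : ℝ => Complex.exp (x * Complex.I) := by fun_prop
    exact (hc.tendsto _).comp hω
  · simp only [hspan _ (hg _)]
    exact tendsto_const_nhds

theorem IsWhiteNoise.memLp_exp_abs_withDensity (hW : IsWhiteNoise P W) {η : Ω → ℝ}
    (hη : Measurable η) (hη2 : MemLp η 2 P) (h : Lp ℝ 2 leb) :
    MemLp (fun ω => Real.exp |W h ω|) 2 (P.withDensity fun ω => ENNReal.ofReal |η ω|) := by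
  have hm := hW.measurable h
  have hm2 : Measurable fun ω => Real.exp |W h ω| := by fun_prop
  rw [memLp_two_iff_integrable_sq hm2.aestronglyMeasurable, integrable_withDensity_abs_iff hη]
  have h1 := hη2.abs.integrable_mul (hW.memLp_exp h 2)
  have h2 := hη2.abs.integrable_mul (hW.memLp_exp h (-2))
  refine (h1.add h2).mono' (by fun_prop) (Eventually.of_forall fun ω => ?_)
  simp only [Pi.add_apply, Pi.mul_apply]
  rw [← mul_add, norm_mul, Real.norm_eq_abs, abs_abs]
  refine mul_le_mul_of_nonneg_left ?_ (abs_nonneg _)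
  rw [Real.norm_of_nonneg (by positivity), ← Real.exp_nat_mul]
  rcases abs_choice (W h ω) with h3 | h3 <;> rw [h3] <;> push_cast
  · linarith [Real.exp_pos (-2 * W h ω)]
  · have : (2 : ℝ) * -W h ω = -2 * W h ω := by ring
    rw [this]
    linarith [Real.exp_pos (2 * W h ω)]

/-- A function orthogonal to all polynomials has vanishing Fourier coefficients along the span of
the cosine basis. -/
theorem IsWhiteNoise.integral_cexp_span_eq_zero (hW : IsWhiteNoise P W) {η f : Ω → ℝ}
    (hη : Measurable η) (hη2 : MemLp η 2 P)
    (hf : MemLp f 2 (P.withDensity fun ω => ENNReal.ofReal |η ω|))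
    (hpoly : ∀ p : MvPolynomial ℕ ℝ,
      ∫ ω, f ω * eval (noise W ω) p ∂(P.withDensity fun ω => ENNReal.ofReal |η ω|) = 0)
    {h : Lp ℝ 2 leb} (hh : h ∈ Submodule.span ℝ (range cosLp)) :
    ∫ ω, (f ω : ℂ) * Complex.exp (W h ω * Complex.I)
      ∂(P.withDensity fun ω => ENNReal.ofReal |η ω|) = 0 := by
  set ν := P.withDensity fun ω => ENNReal.ofReal |η ω| with hν
  obtain ⟨c, hc⟩ := (Finsupp.mem_span_range_iff_exists_finsupp).1 hh
  let L : MvPolynomial ℕ ℝ := ∑ k ∈ c.support, c k • X k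
  have hWL : ∀ᵐ ω ∂ν, W h ω = eval (noise W ω) L := by
    refine (withDensity_absolutelyContinuous P _).ae_le ?_
    filter_upwards [hW.sum_ae c.support c cosLp] with ω hω
    rw [← hc, Finsupp.sum, hω, map_sum]
    simp [noise]
  have hm := hW.measurable h
  have hfm : AEStronglyMeasurable (fun ω => (f ω : ℂ)) ν :=
    Complex.continuous_ofReal.comp_aestronglyMeasurable hf.1
  have hexp : ∀ x : ℝ, HasSum (fun n : ℕ => |x| ^ n / (n.factorial : ℝ)) (Real.exp |x|) := by
    intro x
    rw [Real.exp_eq_exp_ℝ]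
    exact NormedSpace.expSeries_div_hasSum_exp |x|
  have hsum := hasSum_integral_of_dominated_convergence (μ := ν)
    (F := fun (n : ℕ) ω => (f ω : ℂ) * ((W h ω * Complex.I) ^ n / (n.factorial : ℂ)))
    (f := fun ω => (f ω : ℂ) * Complex.exp (W h ω * Complex.I))
    (fun n ω => |f ω| * (|W h ω| ^ n / (n.factorial : ℝ))) ?_ ?_ ?_ ?_ ?_
  · refine hsum.unique ?_
    have hzero : ∀ n : ℕ,
        ∫ ω, (f ω : ℂ) * ((W h ω * Complex.I) ^ n / (n.factorial : ℂ)) ∂ν = 0 := by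
      intro n
      have h1 : ∫ ω, (f ω : ℂ) * ((W h ω * Complex.I) ^ n / (n.factorial : ℂ)) ∂ν =
          ∫ ω, (Complex.I ^ n / (n.factorial : ℂ)) *
            ((f ω * eval (noise W ω) (L ^ n) : ℝ) : ℂ) ∂ν := by
        refine integral_congr_ae ?_
        filter_upwards [hWL] with ω hω
        rw [hω]
        push_cast [map_pow]
        ring
      rw [h1, integral_const_mul, integral_complex_ofReal, hpoly]
      simp
    simp only [hzero]
    exact hasSum_zero
  · intro n
    exact hfm.mul (by fun_prop)
  · intro n
    refine Eventually.of_forall fun ω => ?_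
    simp
  · exact Eventually.of_forall fun ω => ((hexp (W h ω)).mul_left |f ω|).summable
  · have h1 := hf.abs.integrable_mul (hW.memLp_exp_abs_withDensity hη hη2 h)
    refine h1.congr (Eventually.of_forall fun ω => ?_)
    exact ((hexp (W h ω)).mul_left |f ω|).tsum_eq.symm
  · refine Eventually.of_forall fun ω => ?_
    refine HasSum.mul_left _ ?_
    rw [Complex.exp_eq_exp_ℂ]
    exact NormedSpace.expSeries_div_hasSum_exp _

theorem IsWhiteNoise.ae_eq_zero_of_integral_cexp (hW : IsWhiteNoise P W)
    (hm : ‹MeasurableSpace Ω› = sigmaW W) {ν : Measure Ω} [IsFiniteMeasure ν]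
    (hν : ν ≪ P) {f : Ω → ℝ} (hf : Integrable f ν)
    (hexp : ∀ h, ∫ ω, (f ω : ℂ) * Complex.exp (W h ω * Complex.I) ∂ν = 0) :
    ∀ᵐ ω ∂ν, f ω = 0 := by
  classical
  let V : Ω → Lp ℝ 2 leb → ℝ := fun ω h => W h ω
  have hV : Measurable V := measurable_pi_lambda _ fun h => hW.measurable h
  let νp := ν.withDensity fun ω => ENNReal.ofReal (f ω)
  let νm := ν.withDensity fun ω => ENNReal.ofReal (-f ω)
  have hp : IsFiniteMeasure νp := isFiniteMeasure_withDensity_ofReal hf.2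
  have hn : IsFiniteMeasure νm := isFiniteMeasure_withDensity_ofReal hf.neg.2
  have hchar : ∀ h, ∫ ω, Complex.exp (W h ω * Complex.I) ∂νp =
      ∫ ω, Complex.exp (W h ω * Complex.I) ∂νm := by
    intro h
    have hmh := hW.measurable h
    have hb : ∀ g : Ω → ℝ, Integrable g ν →
        Integrable (fun ω => (max (g ω) 0) • Complex.exp (W h ω * Complex.I)) ν := by
      intro g hg
      refine hg.pos_part.smul_bdd 1 (by fun_prop) (Eventually.of_forall fun ω => ?_)
      rw [Complex.norm_exp_ofReal_mul_I]
    have hneg : AEMeasurable (fun ω => ENNReal.ofReal (-f ω)) ν :=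
      hf.1.aemeasurable.neg.ennreal_ofReal
    rw [integral_withDensity_eq_integral_toReal_smul₀ hf.1.aemeasurable.ennreal_ofReal (by simp),
      integral_withDensity_eq_integral_toReal_smul₀ hneg (by simp)]
    simp only [ENNReal.toReal_ofReal']
    rw [← sub_eq_zero, ← integral_sub (hb f hf) (hb (fun ω => -f ω) hf.neg), ← hexp h]
    congr 1
    funext ω
    rw [← sub_smul, max_zero_sub_max_neg_zero_eq_self, Complex.real_smul]
  have hproj : νp.map V = νm.map V := by
    refine IsProjectiveLimit.unique (P := fun I => (νp.map V).map I.restrict) (fun I => rfl)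
      fun I => ?_
    refine Measure.ext_of_charFunDual ?_
    funext L
    have hmap : ∀ μ : Measure Ω, μ ≪ P →
        charFunDual ((μ.map V).map I.restrict) L = ∫ ω, Complex.exp
          (W (∑ i : I, L (Pi.single i 1) • (i : Lp ℝ 2 leb)) ω * Complex.I) ∂μ := by
      intro μ hμ
      have hmI : Measurable (I.restrict (π := fun _ : Lp ℝ 2 leb => ℝ)) := by fun_prop
      rw [charFunDual_apply, Measure.map_map hmI hV,
        integral_map (hmI.comp hV).aemeasurable (by fun_prop)]
      refine integral_congr_ae ?_
      filter_upwards [hμ.ae_le (hW.sum_ae Finset.univ (fun i : I => L (Pi.single i 1))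
        fun i => (i : Lp ℝ 2 leb))] with ω hω
      rw [hω]
      congr 3
      rw [← L.coe_coe, LinearMap.pi_apply_eq_sum_univ L.toLinearMap]
      refine Finset.sum_congr rfl fun i _ => ?_
      rw [smul_eq_mul, mul_comm]
      congr 2
      funext j
      simp [Pi.single_apply, eq_comm]
    rw [hmap νm ((withDensity_absolutelyContinuous _ _).trans hν),
      hmap νp ((withDensity_absolutelyContinuous _ _).trans hν), hchar]
  have hcomap : ∀ s : Set Ω, MeasurableSet s →
      ∃ t : Set (Lp ℝ 2 leb → ℝ), MeasurableSet t ∧ V ⁻¹' t = s := by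
    intro s hs
    have h1 : ‹MeasurableSpace Ω› = MeasurableSpace.comap V MeasurableSpace.pi := by
      rw [hm, sigmaW, MeasurableSpace.pi, MeasurableSpace.comap_iSup]
      simp only [MeasurableSpace.comap_comp]
      rfl
    rw [h1] at hs
    exact hs
  have heq : νp = νm := by
    ext s hs
    obtain ⟨t, ht, rfl⟩ := hcomap s hs
    rw [← Measure.map_apply hV ht, ← Measure.map_apply hV ht, hproj]
  have hae := (withDensity_eq_iff_of_sigmaFinite hf.1.aemeasurable.ennreal_ofReal
    hf.1.aemeasurable.neg.ennreal_ofReal).1 heq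
  filter_upwards [hae] with ω hω
  rcases lt_trichotomy (f ω) 0 with h | h | h
  · rw [ENNReal.ofReal_of_nonpos h.le, eq_comm] at hω
    have := ENNReal.ofReal_eq_zero.1 hω
    simp only [Pi.neg_apply] at this
    linarith
  · exact h
  · have h2 : ENNReal.ofReal (-f ω) = 0 := ENNReal.ofReal_of_nonpos (by linarith)
    have := ENNReal.ofReal_eq_zero.1 (hω.trans h2)
    linarith

variable [IsProbabilityMeasure P]

theorem IsWhiteNoise.memLp_eval_withDensity (hW : IsWhiteNoise P W) {η : Ω → ℝ}
    (hη : Measurable η) (hη2 : MemLp η 2 P) (p : MvPolynomial ℕ ℝ) :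
    MemLp (fun ω => eval (noise W ω) p) 2 (P.withDensity fun ω => ENNReal.ofReal |η ω|) := by
  have hm : AEStronglyMeasurable (fun ω => eval (noise W ω) p)
      (P.withDensity fun ω => ENNReal.ofReal |η ω|) :=
    (hW.memLp_eval p 1 one_ne_zero).1.mono_ac (withDensity_absolutelyContinuous _ _)
  rw [memLp_two_iff_integrable_sq hm, integrable_withDensity_abs_iff hη]
  have := hη2.abs
  refine (hW.integrable_mul_eval this (p ^ 2)).congr (Eventually.of_forall fun ω => ?_)
  simp

/-- Polynomials in the noise are dense in `L₂(|η| P)`. -/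
theorem IsWhiteNoise.exists_polynomial_near (hW : IsWhiteNoise P W)
    (hm : ‹MeasurableSpace Ω› = sigmaW W) {η : Ω → ℝ} (hη : Measurable η) (hη2 : MemLp η 2 P)
    {A : Set Ω} (hA : MeasurableSet A) {ε : ℝ} (hε : 0 < ε) :
    ∃ p : MvPolynomial ℕ ℝ,
      ∫ ω, |η ω| * (A.indicator 1 ω - eval (noise W ω) p) ^ 2 ∂P < ε := by
  set ν := P.withDensity fun ω => ENNReal.ofReal |η ω| with hν
  have hηi : Integrable η P := hη2.integrable (by norm_num)
  have hfin : IsFiniteMeasure ν := isFiniteMeasure_withDensity_ofReal hηi.abs.2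
  have hmem := fun p => hW.memLp_eval_withDensity hη hη2 p
  let Φ : MvPolynomial ℕ ℝ →ₗ[ℝ] Lp ℝ 2 ν :=
    { toFun := fun p => (hmem p).toLp _
      map_add' := fun p q => by
        rw [← MemLp.toLp_add]
        refine MemLp.toLp_congr _ _ (Eventually.of_forall fun ω => ?_)
        simp
      map_smul' := fun r p => by
        rw [RingHom.id_apply, ← MemLp.toLp_const_smul]
        refine MemLp.toLp_congr _ _ (Eventually.of_forall fun ω => ?_)
        simp }
  have hΦ : ∀ p, Φ p =ᵐ[ν] fun ω => eval (noise W ω) p := fun p =>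
    MemLp.coeFn_toLp (hmem p)
  have htop : (LinearMap.range Φ).topologicalClosure = ⊤ := by
    rw [Submodule.topologicalClosure_eq_top_iff, eq_bot_iff]
    intro g hg
    rw [Submodule.mem_bot, Lp.eq_zero_iff_ae_eq_zero]
    refine hW.ae_eq_zero_of_integral_cexp hm (withDensity_absolutelyContinuous _ _)
      ((Lp.memLp g).integrable (by norm_num)) ?_
    refine hW.integral_cexp_eq_zero (withDensity_absolutelyContinuous _ _)
      ((Lp.memLp g).integrable (by norm_num)) fun h hh => ?_
    refine hW.integral_cexp_span_eq_zero hη hη2 (Lp.memLp g) (fun p => ?_) hh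
    have h1 := (Submodule.mem_orthogonal _ _).1 hg (Φ p) ⟨p, rfl⟩
    rw [L2.inner_def] at h1
    rw [← h1]
    refine integral_congr_ae ?_
    filter_upwards [hΦ p] with ω hω
    rw [hω]
    simp
  have hAmem : MemLp (A.indicator (1 : Ω → ℝ)) 2 ν := (memLp_const (1 : ℝ)).indicator hA
  have hcl : hAmem.toLp _ ∈ closure (LinearMap.range Φ : Set (Lp ℝ 2 ν)) := by
    rw [← Submodule.topologicalClosure_coe, htop]
    trivial
  obtain ⟨_, ⟨p, rfl⟩, hp⟩ := Metric.mem_closure_iff.1 hcl (√ε) (Real.sqrt_pos.2 hε)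
  refine ⟨p, ?_⟩
  have h2 : ‖hAmem.toLp _ - Φ p‖ ^ 2 < ε := by
    rw [dist_eq_norm] at hp
    calc _ < √ε ^ 2 := pow_lt_pow_left₀ hp (norm_nonneg _) two_ne_zero
      _ = ε := Real.sq_sqrt hε.le
  rw [← real_inner_self_eq_norm_sq, L2.inner_def] at h2
  refine lt_of_eq_of_lt ?_ h2
  rw [← integral_withDensity_abs hη]
  refine integral_congr_ae ?_
  filter_upwards [hΦ p, hAmem.coeFn_toLp, Lp.coeFn_sub (hAmem.toLp _) (Φ p)] with ω e1 e2 e3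
  rw [e3, Pi.sub_apply, e1, e2]
  simp [sq]

theorem IsWhiteNoise.ae_nonneg_of_measurable (hW : IsWhiteNoise P W)
    (hm : ‹MeasurableSpace Ω› = sigmaW W) {η : Ω → ℝ} (hη : Measurable η) (hη2 : MemLp η 2 P)
    (hpos : ∀ p : MvPolynomial ℕ ℝ, 0 ≤ ∫ ω, η ω * eval (noise W ω) (p ^ 2) ∂P) :
    ∀ᵐ ω ∂P, 0 ≤ η ω := by
  set A : Set Ω := {ω | η ω < 0} with hA
  have hAm : MeasurableSet A := measurableSet_lt hη measurable_const
  have hηi : Integrable η P := hη2.integrable (by norm_num)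
  have hbound : ∀ ε > 0, ∫ ω, A.indicator (fun ω => |η ω|) ω ∂P ≤ 4 * ε := by
    intro ε hε
    obtain ⟨p, hp⟩ := hW.exists_polynomial_near hm hη hη2 hAm hε
    have hi1 := hW.integrable_mul_eval hη2 (p ^ 2)
    have hi2 : Integrable (fun ω => |η ω| * (A.indicator 1 ω - eval (noise W ω) p) ^ 2) P := by
      rw [← integrable_withDensity_abs_iff hη]
      have hfin : IsFiniteMeasure (P.withDensity fun ω => ENNReal.ofReal |η ω|) :=
        isFiniteMeasure_withDensity_ofReal hηi.abs.2
      exact (((memLp_const (1 : ℝ)).indicator hAm).sub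
        (hW.memLp_eval_withDensity hη hη2 p)).integrable_sq
    have h1 : ∫ ω, A.indicator (fun ω => |η ω|) ω ∂P ≤
        ∫ ω, (4 * (|η ω| * (A.indicator 1 ω - eval (noise W ω) p) ^ 2) -
          2 * (η ω * eval (noise W ω) (p ^ 2))) ∂P := by
      refine integral_mono (hηi.abs.indicator hAm) ((hi2.const_mul 4).sub (hi1.const_mul 2))
        fun ω => ?_
      simp only [map_pow]
      by_cases hω : ω ∈ A
      · have hneg : η ω < 0 := hω
        simp only [indicator_of_mem hω, Pi.one_apply, abs_of_neg hneg]
        nlinarith [mul_nonneg (neg_nonneg.2 hneg.le) (sq_nonneg (3 * eval (noise W ω) p - 2))]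
      · have hnn : 0 ≤ η ω := not_lt.1 hω
        simp only [indicator_of_notMem hω, abs_of_nonneg hnn]
        nlinarith [mul_nonneg hnn (sq_nonneg (eval (noise W ω) p))]
    rw [integral_sub (hi2.const_mul 4) (hi1.const_mul 2), integral_const_mul,
      integral_const_mul] at h1
    linarith [hpos p]
  have hzero : ∫ ω, A.indicator (fun ω => |η ω|) ω ∂P ≤ 0 := by
    refine le_of_forall_pos_le_add fun ε hε => ?_
    linarith [hbound (ε / 4) (by positivity)]
  have hae := (integral_eq_zero_iff_of_nonneg
    (fun ω => indicator_nonneg (fun _ _ => abs_nonneg _) ω) (hηi.abs.indicator hAm)).1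
    (le_antisymm hzero (integral_nonneg fun ω => indicator_nonneg (fun _ _ => abs_nonneg _) ω))
  filter_upwards [hae] with ω hω
  by_contra hneg
  rw [indicator_of_mem (show ω ∈ A from not_le.1 hneg)] at hω
  exact hneg (abs_eq_zero.1 hω).ge

end Determinacy

/-- Square integrable functionals of the noise with `E (η p²) ≥ 0` for all polynomials `p` in the
noise are non-negative. -/
theorem IsWhiteNoise.ae_nonneg {Ω : Type*} [mΩ : MeasurableSpace Ω] {P : Measure Ω}
    [IsProbabilityMeasure P] {W : Lp ℝ 2 leb → Ω → ℝ} (hW : IsWhiteNoise P W) {η : Ω → ℝ}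
    (hη : InL2W P W η)
    (hpos : ∀ p : MvPolynomial ℕ ℝ, 0 ≤ ∫ ω, η ω * eval (noise W ω) (p ^ 2) ∂P) :
    ∀ᵐ ω ∂P, 0 ≤ η ω := by
  have hle : sigmaW W ≤ mΩ := iSup_le fun h => (hW.measurable h).comap_le
  have hWm : ∀ h, Measurable[sigmaW W] (W h) := fun h =>
    Measurable.mono (comap_measurable (W h)) (le_iSup (fun h =>
      MeasurableSpace.comap (W h) (borel ℝ)) h) le_rfl
  obtain ⟨⟨η', hη', hηη'⟩, hη2⟩ := hη
  have hprob : IsProbabilityMeasure (P.trim hle) :=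
    ⟨by rw [trim_measurableSet_eq hle MeasurableSet.univ]; exact measure_univ⟩
  have hW' : @IsWhiteNoise Ω (sigmaW W) (P.trim hle) W := by
    refine @IsWhiteNoise.mk Ω (sigmaW W) (P.trim hle) W hWm (fun h => ?_) (fun h => ?_)
      fun g h => ?_
    · have hmap : @Measure.map Ω ℝ (sigmaW W) _ (W h) (P.trim hle) = P.map (W h) := by
        ext s hs
        rw [Measure.map_apply (hWm h) hs, Measure.map_apply (hW.measurable h) hs,
          trim_measurableSet_eq hle (hWm h hs)]
      rw [hmap]
      exact hW.gaussian h
    · rw [← integral_trim hle (hWm h).stronglyMeasurable]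
      exact hW.mean h
    · have hgh : Measurable[sigmaW W] fun ω => W g ω * W h ω := (hWm g).mul (hWm h)
      rw [← integral_trim hle hgh.stronglyMeasurable]
      exact hW.covariance g h
  have hevm : ∀ p : MvPolynomial ℕ ℝ, Measurable[sigmaW W] fun ω => eval (noise W ω) p := by
    intro p
    induction p using MvPolynomial.induction_on with
    | C a => simp
    | add p q hp hq => simp only [map_add]; exact hp.add hq
    | mul_X p i hp =>
      simp only [map_mul, eval_X]
      exact hp.mul (hWm (cosLp i))
  have hmain := @IsWhiteNoise.ae_nonneg_of_measurable Ω (sigmaW W) (P.trim hle) W hprob hW' rfl η'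
    hη'.measurable ⟨hη'.aestronglyMeasurable, by
      rw [eLpNorm_trim hle hη']; exact (hη2.ae_eq hηη').2⟩ fun p => by
      have hpm : Measurable[sigmaW W] fun ω => η' ω * eval (noise W ω) (p ^ 2) :=
        hη'.measurable.mul (hevm _)
      rw [← integral_trim hle hpm.stronglyMeasurable]
      refine (hpos p).trans_eq (integral_congr_ae ?_)
      filter_upwards [hηη'] with ω hω
      rw [hω]
  filter_upwards [hηη', ae_of_ae_trim hle hmain] with ω h1 h2
  rwa [h1]

end WickHeat

theorem mainTheorem8 {Ω : Type*} [MeasurableSpace Ω] (P : Measure Ω) [IsProbabilityMeasure P]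
    (W : Lp ℝ 2 WickHeat.leb → Ω → ℝ) (hW : WickHeat.IsWhiteNoise P W)
    (T : ℝ) (hT : 0 < T) (p : ℝ≥0∞) [Fact (1 ≤ p)]
    (u₀ : ℝ → ℝ) (hu₀ : Integrable u₀ WickHeat.leb) (hpos : ∀ x ∈ Icc 0 Real.pi, 0 ≤ u₀ x)
    (u : ℝ → ℝ → Ω → ℝ) (hu : WickHeat.IsRandomFieldSolution P W T u₀ u)
    (hLp : WickHeat.InL2Lp P T p u) :
    (∀ t ∈ Icc 0 T, ∀ x ∈ Icc 0 Real.pi, ∀ᵐ ω ∂P, 0 ≤ u t x ω) ∧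
    (∀ S : Set (ℝ × ℝ), S ⊆ Icc 0 T ×ˢ Icc 0 Real.pi →
      (∀ᵐ ω ∂P, ContinuousOn (fun z : ℝ × ℝ => u z.1 z.2 ω) S) →
      ∀ᵐ ω ∂P, ∀ z ∈ S, 0 ≤ u z.1 z.2 ω) := by
  obtain ⟨U, hU, hchaos⟩ := hu
  have hpt : ∀ t ∈ Icc 0 T, ∀ x ∈ Icc 0 Real.pi, ∀ᵐ ω ∂P, 0 ≤ u t x ω := by
    intro t ht x hx
    have hη := (hchaos t ht x hx).1
    refine hW.ae_nonneg hη fun q => ?_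
    rw [← hW.pairing_apply hη.2]
    exact hW.pairing_sq_nonneg hU hu₀ hpos hchaos ht hx q
  refine ⟨hpt, fun S hS hcont => ?_⟩
  obtain ⟨D, hDS, hD, hSD⟩ :=
    (TopologicalSpace.IsSeparable.of_separableSpace S).exists_countable_dense_subset
  have hall : ∀ᵐ ω ∂P, ∀ z ∈ D, 0 ≤ u z.1 z.2 ω :=
    (ae_ball_iff hD).2 fun z hz => hpt z.1 (hS (hDS hz)).1 z.2 (hS (hDS hz)).2
  filter_upwards [hall, hcont] with ω h1 h2 z hz
  have hmem : z ∈ closure D := hSD hz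
  have h3 := ((h2 z hz).mono hDS).mem_closure_image hmem
  refine (isClosed_Ici (a := (0 : ℝ))).closure_subset_iff.2 ?_ h3
  rintro _ ⟨w, hw, rfl⟩
  exact h1 w hw
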